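/- Let $d\ge1$, let $\Omega\subset\mathbb R^d$ be a bounded open set with Lipschitz boundary, $T>0$, $0<\alpha<1$. Write $\langle\cdot,\cdot\rangle$ for the inner product of $L_2(\Omega)$ or $L_2(\Omega)^d$, $H^1_0(\Omega)$ for the closure of $C_c^\infty(\Omega)$ in $H^1(\Omega)$, $\omega_\mu(t)=t^{\mu-1}/\Gamma(\mu)$ and $\mathcal I^\mu\phi(t)=\int_0^t\omega_\mu(t-s)\phi(s)\,ds$. Assume that - $\kappa\in L_\infty(\Omega)^{d\times d}$ is real, symmetric and uniformly positive definite, that is, for some $c>0$ the minimal eigenvalue of $\kappa(x)$ is at least $c$ for almost every $x\in\Omega$; - $\vec F,\vec G\in C^2([0,T];W^1_\infty(\Omega)^d)$ and $a,b\in C^1([0,T];L_\infty(\Omega))$; - $u_0\in L_2(\Omega)$, and $g:(0,T]\to L_2(\Omega)$ is measurable with $\|g(t)\|\le Mt^{\eta-1}$ for $0<t\le T$ and some constants $M,\eta>0$. Put $f(t)=u_0+\int_0^tg(s)\,ds$ and $$\vec B_1u=B^\alpha_{\vec F}u+B^1_{\vec G}u,\qquad B_2u=B^\alpha_au+B^1_bu,\qquad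 (B^\mu_\psi\phi)(t)=\psi(t)\,\mathcal I^\mu\phi(t)-\int_0^t\psi'(s)\,\mathcal I^\mu\phi(s)\,ds .$$ Consider functions $u:[0,T]\to L_2(\Omega)$ such that $u$ and $\mathcal I^\alpha u$ belong to $L_2((0,T);L_2(\Omega))$, such that $\mathcal I^\alpha u(t)\in H^1_0(\Omega)$ for almost every $t$ with gradient $\mathcal I^\alpha\nabla u:=\nabla\mathcal I^\alpha u\in L_2((0,T);L_2(\Omega)^d)$, and such that for almost every $t\in(0,T)$ $$\langle u(t),v\rangle+\langle\kappa(\mathcal I^\alpha\nabla u)(t),\nabla v\rangle-\langle(\vec B_1u)(t),\nabla v\rangle+\langle(B_2u)(t),v\rangle=\langle f(t),v\rangle\quad\text{for all }v\in H^1_0(\Omega).\tag{$*$}$$ Then there is at most one such function: if $u_1$ and $u_2$ are two of them, then $u_1(t)=u_2(t)$ for almost every $t\in(0,T)$. Moreover, $u_1(t)=u_2(t)$ at every $t\in[0,T]$ at which, for both of them, the integral $\mathcal I^\alpha u_i(t)$ converges in $L_2(\Omega)$ to an element of $H^1_0(\Omega)$ and $(*)$ holds; in particular, if this is so for all $t\in[0,T]$,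 then $u_1=u_2$ on $[0,T]$. -/

import Mathlib

open MeasureTheory Set
open scoped ENNReal ContDiff

noncomputable section

namespace FracPDE

/-- Euclidean space `ℝ^d`. -/
abbrev E (d : ℕ) := EuclideanSpace ℝ (Fin d)

/-- A set whose boundary is locally, in suitable orthogonal coordinates, the graph of a Lipschitz
function with the set lying strictly on one side of it. The unit vector `n` is the direction of the
last coordinate, and `γ`, being invariant along `n`, is a function of the remaining ones. -/
def HasLipschitzBoundary {d : ℕ} (Ω : Set (E d)) : Prop :=
  ∀ x ∈ frontier Ω, ∃ (U : Set (E d)) (n : E d) (γ : E d → ℝ) (K : NNReal),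
    IsOpen U ∧ x ∈ U ∧ ‖n‖ = 1 ∧ LipschitzWith K γ ∧ (∀ y, ∀ c : ℝ, γ (y + c • n) = γ y) ∧
      Ω ∩ U = {y | y ∈ U ∧ γ y < inner ℝ y n}

/-- The space `L_p(Ω; V)` (Lebesgue measure). -/
abbrev LpOn {d : ℕ} (Ω : Set (E d)) (V : Type) [NormedAddCommGroup V] (p : ℝ≥0∞) :=
  Lp V p (volume.restrict Ω)

/-- Test functions: elements of `C_c^∞(Ω)`. -/
def IsTestFunction {d : ℕ} (Ω : Set (E d)) (φ : E d → ℝ) : Prop :=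
  ContDiff ℝ ∞ φ ∧ HasCompactSupport φ ∧ tsupport φ ⊆ Ω

/-- The space `H^1_0(Ω)`, the closure of `C_c^∞(Ω)` in the `H^1` norm; a function `v` in it is
recorded together with its gradient `∇v`, as the pair `(v, ∇v)` in `L_2(Ω) × L_2(Ω)^d`. -/
def H10 {d : ℕ} (Ω : Set (E d)) : Set (LpOn Ω ℝ 2 × LpOn Ω (E d) 2) :=
  closure {w | ∃ φ : E d → ℝ, IsTestFunction Ω φ ∧
    w.1 =ᵐ[volume.restrict Ω] φ ∧ w.2 =ᵐ[volume.restrict Ω] gradient φ}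

/-- `DF` is the weak derivative of the vector field `F` on `Ω`. -/
def HasWeakDeriv {d : ℕ} (Ω : Set (E d)) (F : LpOn Ω (E d) ∞) (DF : LpOn Ω (E d →L[ℝ] E d) ∞) :
    Prop :=
  ∀ φ : E d → ℝ, IsTestFunction Ω φ → ∀ y : E d,
    ∫ x in Ω, (fderiv ℝ φ x y) • F x = - ∫ x in Ω, φ x • DF x y

/-- `F ∈ C^k([0,T]; W^1_∞(Ω)^d)`: both `F` and its weak space derivative are `C^k` functions of
time with values in `L_∞`. -/
def ContDiffW1Inf {d : ℕ} (Ω : Set (E d)) (T : ℝ) (k : ℕ) (F : ℝ → LpOn Ω (E d) ∞) : Prop :=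
  ContDiffOn ℝ k F (Icc 0 T) ∧ ∃ DF : ℝ → LpOn Ω (E d →L[ℝ] E d) ∞,
    ContDiffOn ℝ k DF (Icc 0 T) ∧ ∀ t ∈ Icc 0 T, HasWeakDeriv Ω (F t) (DF t)

/-- The kernel `ω_μ(t) = t^(μ-1) / Γ(μ)`. -/
def omega (μ t : ℝ) : ℝ := t ^ (μ - 1) / Real.Gamma μ

/-- The fractional integral `(I^μ φ)(t) = ∫_0^t ω_μ(t-s) φ(s) ds` (a Bochner integral). -/
def fracInt {V : Type} [NormedAddCommGroup V] [NormedSpace ℝ V] (μ : ℝ) (φ : ℝ → V) (t : ℝ) : V :=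
  ∫ s in 0..t, omega μ (t - s) • φ s

/-- The operator `(B^μ_ψ φ)(t) = ψ(t) (I^μ φ)(t) - ∫_0^t ψ'(s) (I^μ φ)(s) ds` on scalar functions
`φ`, for a coefficient `ψ : [0,T] → L_∞(Ω; V)`. The product of a scalar function and a
`V`-valued one is the pointwise one, `L_2(Ω) × L_∞(Ω; V) → L_2(Ω; V)`. -/
def opB {d : ℕ} {Ω : Set (E d)} {V : Type} [NormedAddCommGroup V] [NormedSpace ℝ V] (T μ : ℝ)
    (ψ : ℝ → LpOn Ω V ∞) (φ : ℝ → LpOn Ω ℝ 2) (t : ℝ) : LpOn Ω V 2 :=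
  ((fracInt μ φ t • ψ t : LpOn Ω V 2)) -
    ∫ s in 0..t, (fracInt μ φ s • derivWithin ψ (Icc 0 T) s : LpOn Ω V 2)

/-- The data of the problem
`∂_t u - ∇·(κ ∇∂_t^{1-α} u - F ∂_t^{1-α} u - G u) + a ∂_t^{1-α} u + b u = g`, `u(0) = u₀`. -/
structure Data {d : ℕ} (Ω : Set (E d)) where
  κ : E d → Matrix (Fin d) (Fin d) ℝ
  F : ℝ → LpOn Ω (E d) ∞
  G : ℝ → LpOn Ω (E d) ∞
  a : ℝ → LpOn Ω ℝ ∞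
  b : ℝ → LpOn Ω ℝ ∞
  g : ℝ → LpOn Ω ℝ 2
  u₀ : LpOn Ω ℝ 2

namespace Data

variable {d : ℕ} {Ω : Set (E d)}

/-- The assumptions on the coefficients and on the source term. -/
structure Admissible (D : Data Ω) (T : ℝ) : Prop where
  kappa_bounded : ∀ i j, MemLp (fun x => D.κ x i j) ∞ (volume.restrict Ω)
  kappa_symm : ∀ᵐ x ∂(volume.restrict Ω), (D.κ x).IsSymm
  kappa_elliptic : ∃ c > 0, ∀ᵐ x ∂(volume.restrict Ω), ∀ ξ : Fin d → ℝ,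
    c * (ξ ⬝ᵥ ξ) ≤ ξ ⬝ᵥ (D.κ x).mulVec ξ
  F_reg : ContDiffW1Inf Ω T 2 D.F
  G_reg : ContDiffW1Inf Ω T 2 D.G
  a_reg : ContDiffOn ℝ 1 D.a (Icc 0 T)
  b_reg : ContDiffOn ℝ 1 D.b (Icc 0 T)
  g_meas : AEStronglyMeasurable D.g (volume.restrict (Ioc 0 T))
  g_bound : ∃ M > 0, ∃ η > 0, ∀ t ∈ Ioc 0 T, ‖D.g t‖ ≤ M * t ^ (η - 1)

/-- The form `⟨κ p, q⟩` for `p, q ∈ L_2(Ω)^d`. -/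
def kappaForm (D : Data Ω) (p q : LpOn Ω (E d) 2) : ℝ :=
  ∫ x in Ω, (D.κ x).mulVec (p x).ofLp ⬝ᵥ (q x).ofLp

/-- `B₁ u`, the integrated-by-parts form of `∫_0^t (F ∂_s^{1-α} u + G u) ds`. -/
def B₁ (D : Data Ω) (T α : ℝ) (u : ℝ → LpOn Ω ℝ 2) (t : ℝ) : LpOn Ω (E d) 2 :=
  opB T α D.F u t + opB T 1 D.G u t

/-- `B₂ u`, the integrated-by-parts form of `∫_0^t (a ∂_s^{1-α} u + b u) ds`. -/
def B₂ (D : Data Ω) (T α : ℝ) (u : ℝ → LpOn Ω ℝ 2) (t : ℝ) : LpOn Ω ℝ 2 :=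
  opB T α D.a u t + opB T 1 D.b u t

/-- `f(t) = u₀ + ∫_0^t g(s) ds`. -/
def f (D : Data Ω) (t : ℝ) : LpOn Ω ℝ 2 := D.u₀ + ∫ s in 0..t, D.g s

/-- The weak formulation at time `t`: the integral `(I^α u)(t)` converges in `L_2(Ω)` to an element
of `H^1_0(Ω)`, whose gradient is `p = (I^α ∇u)(t)`, and for all `v ∈ H^1_0(Ω)`,
`⟨u(t), v⟩ + ⟨κ (I^α ∇u)(t), ∇v⟩ - ⟨(B₁u)(t), ∇v⟩ + ⟨(B₂u)(t), v⟩ = ⟨f(t), v⟩`. -/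
def WeakEqAt (D : Data Ω) (T α : ℝ) (u : ℝ → LpOn Ω ℝ 2) (p : LpOn Ω (E d) 2) (t : ℝ) : Prop :=
  IntervalIntegrable (fun s => omega α (t - s) • u s) volume 0 t ∧
  (fracInt α u t, p) ∈ H10 Ω ∧
  ∀ v ∈ H10 Ω,
    inner ℝ (u t) v.1 + D.kappaForm p v.2 - inner ℝ (D.B₁ T α u t) v.2 + inner ℝ (D.B₂ T α u t) v.1
      = inner ℝ (D.f t) v.1

/-- `u` is a weak solution with `u, I^α u ∈ L_2((0,T); L_2(Ω))` and
`I^α ∇u ∈ L_2((0,T); L_2(Ω)^d)`; the weak formulation is imposed for almost every `t`. -/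
structure IsWeakSolution (D : Data Ω) (T α : ℝ) (u : ℝ → LpOn Ω ℝ 2) : Prop where
  memLp : MemLp u 2 (volume.restrict (Ioo 0 T))
  memLp_fracInt : MemLp (fracInt α u) 2 (volume.restrict (Ioo 0 T))
  weak : ∃ P : ℝ → LpOn Ω (E d) 2, MemLp P 2 (volume.restrict (Ioo 0 T)) ∧
    ∀ᵐ t ∂(volume.restrict (Ioo 0 T)), D.WeakEqAt T α u (P t) t

end Data

end FracPDE

end

/-! Put `u = u₁ - u₂` and test the difference of the two equations with `I^α u(t)`, which lies in
`H10` together with its gradient. Ellipticity of `κ` absorbs the gradient term, so `⟨u, I^α u⟩ ≤ C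
S²` almost everywhere, where `S` is built from `‖I^α u‖`, `‖I^1 u‖` and the primitives of these
norms (`inner_sub_fracInt_le`).

The opposing bound is `exists_weight_coercive`: after integration against `exp (-2lt)`, the left
side dominates any prescribed multiple of the squares of `I^α u` and `I^1 u`, provided `l` is large.
It rests on the complete monotonicity of the kernel, `ω_α(τ) = ∫ exp (-rτ) dμ(r)` with `μ =
kernelMeasure α`. Hence `I^α u = ∫ y_r dμ(r)`, where `y_r = expConv r u` solves `y' + r y = u`,
`y(0) = 0`. Testing this equation with `y_r` bounds `(r + l)` times the weighted energy of `y_r` by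
the weighted integral of `⟨u, y_r⟩`, and integration in `r` gives `integral_energy_le`.
Cauchy-Schwarz in `r` then controls `I^α u` with the factor `∫ (r + l)⁻¹ dμ`, which tends to `0`;
the relation `I^1 u = y_r + r ∫ y_r`, averaged over `0 < r ≤ 1`, controls `I^1 u` with a factor of
order `1 / l`.

Comparing the two bounds forces `I^α u = 0` almost everywhere and `I^1 u = 0` everywhere
(`fracInt_eq_zero_of_inner_le`). The lower-order operators then vanish on `u`, the equation loses
its gradient term as well, and density of `H10` in `L_2` gives `u = 0`. -/

namespace FracPDE

/-! ### Energy estimates for primitives and exponential convolutions -/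

section Energy

variable {H : Type*} [NormedAddCommGroup H]

/-- Interchange of the order of integration over a triangle. -/
theorem integral_triangle_swap [NormedSpace ℝ H] {t : ℝ} (ht : 0 ≤ t) {g : ℝ → ℝ → H}
    (hg : Integrable (Function.uncurry g)
      ((volume.restrict (Ioc 0 t)).prod (volume.restrict (Ioc 0 t)))) :
    ∫ a in 0..t, ∫ b in a..t, g a b = ∫ b in 0..t, ∫ a in 0..b, g a b := by
  have hset : MeasurableSet {z : ℝ × ℝ | z.1 < z.2} := measurableSet_lt measurable_fst measurable_snd
  -- The strict inequality matches `Ioc a t` exactly; on the other side it leaves `Ioo 0 b`, which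
  -- differs from `Ioc 0 b` by a null set.
  have key := integral_integral_swap (f := fun a b => if a < b then g a b else 0)
    (μ := volume.restrict (Ioc 0 t)) (ν := volume.restrict (Ioc 0 t))
    ((hg.indicator hset).congr (Filter.Eventually.of_forall fun z => by
      simp [indicator, Function.uncurry]))
  rw [intervalIntegral.integral_of_le ht, intervalIntegral.integral_of_le ht]
  convert key using 1
  · refine setIntegral_congr_fun measurableSet_Ioc fun a ha => ?_
    rw [intervalIntegral.integral_of_le ha.2, ← integral_indicator measurableSet_Ioc,
      ← integral_indicator measurableSet_Ioc]
    congr 1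
    ext b
    simp only [indicator, mem_Ioc]
    split_ifs <;> first | rfl | (exfalso; grind)
  · refine setIntegral_congr_fun measurableSet_Ioc fun b hb => ?_
    rw [intervalIntegral.integral_of_le hb.1.le, integral_Ioc_eq_integral_Ioo,
      ← integral_indicator measurableSet_Ioo, ← integral_indicator measurableSet_Ioc]
    congr 1
    ext a
    simp only [indicator, mem_Ioc, mem_Ioo]
    split_ifs <;> first | rfl | (exfalso; grind)

/-- Integration by parts against a primitive, in integrated form. -/
theorem integral_smul_primitive [NormedSpace ℝ H] [CompleteSpace H] {t : ℝ} (ht : 0 ≤ t)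
    {φ : ℝ → ℝ} {h : ℝ → H} (hφ : IntervalIntegrable φ volume 0 t)
    (hh : IntervalIntegrable h volume 0 t) :
    ∫ b in 0..t, φ b • ∫ a in 0..b, h a = ∫ a in 0..t, (∫ b in a..t, φ b) • h a := by
  have hi : Integrable (Function.uncurry fun a b => φ b • h a)
      ((volume.restrict (Ioc 0 t)).prod (volume.restrict (Ioc 0 t))) := by
    have := Integrable.smul_prod (R := ℝ) hφ.1 hh.1
    exact this.swap
  have := integral_triangle_swap ht hi
  simp only [intervalIntegral.integral_smul, intervalIntegral.integral_smul_const] at this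
  exact this.symm

variable [InnerProductSpace ℝ H]

theorem intervalIntegrable_inner_primitive {t : ℝ} (ht : 0 ≤ t) {U : ℝ → H}
    (hU : IntervalIntegrable U volume 0 t) :
    IntervalIntegrable (fun a => inner ℝ (U a) (∫ b in 0..a, U b)) volume 0 t := by
  have hcont : ContinuousOn (fun a => ∫ b in 0..a, U b) (uIcc 0 t) :=
    intervalIntegral.continuousOn_primitive_interval' hU left_mem_uIcc
  obtain ⟨C, hC⟩ := isCompact_uIcc.exists_bound_of_continuousOn hcont
  rw [intervalIntegrable_iff_integrableOn_Ioc_of_le ht]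
  have hms : AEStronglyMeasurable (fun a => ∫ b in 0..a, U b) (volume.restrict (Ioc 0 t)) :=
    (hcont.mono (by rw [uIcc_of_le ht]; exact Ioc_subset_Icc_self)).aestronglyMeasurable
      measurableSet_Ioc
  refine (hU.1.norm.mul_const C).mono (hU.1.aestronglyMeasurable.inner hms) ?_
  filter_upwards [ae_restrict_mem measurableSet_Ioc] with a ha
  refine (norm_inner_le_norm _ _).trans ((mul_le_mul_of_nonneg_left (hC a ?_)
    (norm_nonneg _)).trans (le_abs_self _))
  rw [uIcc_of_le ht]; exact Ioc_subset_Icc_self ha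

/-- By symmetry the square `(0,t]²` contributes twice the integral of `⟨U a, U b⟩` over a triangle.
This avoids differentiating the primitive of a merely integrable `U`. -/
theorem norm_sq_primitive [CompleteSpace H] {t : ℝ} (ht : 0 ≤ t) {U : ℝ → H}
    (hU : IntervalIntegrable U volume 0 t) :
    ‖∫ s in 0..t, U s‖ ^ 2 = 2 * ∫ a in 0..t, inner ℝ (U a) (∫ b in 0..a, U b) := by
  have hsub : ∀ a ∈ Icc 0 t, IntervalIntegrable U volume 0 a ∧ IntervalIntegrable U volume a t :=
    fun a ha => ⟨hU.mono_set (by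
      rw [uIcc_of_le ha.1, uIcc_of_le ht]; exact Icc_subset_Icc_right ha.2), hU.mono_set (by
      rw [uIcc_of_le ha.2, uIcc_of_le ht]; exact Icc_subset_Icc_left ha.1)⟩
  have hi : Integrable (Function.uncurry fun a b => inner ℝ (U a) (U b))
      ((volume.restrict (Ioc 0 t)).prod (volume.restrict (Ioc 0 t))) := by
    refine (Integrable.mul_prod hU.1.norm hU.1.norm).mono
      (hU.1.aestronglyMeasurable.comp_fst.inner hU.1.aestronglyMeasurable.comp_snd)
      (Filter.Eventually.of_forall fun z => ?_)
    simp only [Function.uncurry]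
    refine (norm_inner_le_norm _ _).trans (le_abs_self _)
  have htri := integral_triangle_swap ht hi
  have hin : ∀ a ∈ Icc 0 t, ∀ x : H, inner ℝ x (∫ b in 0..a, U b) = ∫ b in 0..a, inner ℝ x (U b) :=
    fun a ha x => ((innerSL ℝ x).intervalIntegral_comp_comm (hsub a ha).1).symm
  have hin' : ∀ a ∈ Icc 0 t, ∀ x : H, inner ℝ x (∫ b in a..t, U b) = ∫ b in a..t, inner ℝ x (U b) :=
    fun a ha x => ((innerSL ℝ x).intervalIntegral_comp_comm (hsub a ha).2).symm
  have hI1 := intervalIntegrable_inner_primitive ht hU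
  have hI0 : IntervalIntegrable (fun a => inner ℝ (U a) (∫ b in 0..t, U b)) volume 0 t := by
    rw [intervalIntegrable_iff_integrableOn_Ioc_of_le ht]
    exact hU.1.inner_const _
  have hsplit : ∀ a ∈ uIcc 0 t, inner ℝ (U a) (∫ b in a..t, U b) =
      inner ℝ (U a) (∫ b in 0..t, U b) - inner ℝ (U a) (∫ b in 0..a, U b) := by
    intro a ha
    rw [uIcc_of_le ht] at ha
    rw [← inner_sub_right, ← intervalIntegral.integral_add_adjacent_intervals (hsub a ha).1
      (hsub a ha).2, add_sub_cancel_left]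
  have h1 : ∫ a in 0..t, ∫ b in a..t, inner ℝ (U a) (U b) =
      ‖∫ s in 0..t, U s‖ ^ 2 - ∫ a in 0..t, inner ℝ (U a) (∫ b in 0..a, U b) := by
    rw [← real_inner_self_eq_norm_sq, hin t ⟨ht, le_rfl⟩, intervalIntegral.integral_congr
      (g := fun b => inner ℝ (U b) (∫ s in 0..t, U s)) (fun b _ => real_inner_comm _ _),
      ← intervalIntegral.integral_sub hI0 hI1]
    refine intervalIntegral.integral_congr fun a ha => ?_
    rw [← hsplit a ha, hin' a (by rwa [uIcc_of_le ht] at ha)]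
  have h2 : ∫ b in 0..t, ∫ a in 0..b, inner ℝ (U a) (U b) =
      ∫ a in 0..t, inner ℝ (U a) (∫ b in 0..a, U b) := by
    refine intervalIntegral.integral_congr fun a ha => ?_
    rw [hin a (by rwa [uIcc_of_le ht] at ha)]
    exact intervalIntegral.integral_congr fun b _ => real_inner_comm _ _
  linarith

theorem integral_exp_weight (β a T : ℝ) :
    ∫ b in a..T, 2 * β * Real.exp (-(2 * β * b)) =
      Real.exp (-(2 * β * a)) - Real.exp (-(2 * β * T)) := by
  have := intervalIntegral.integral_eq_sub_of_hasDerivAt (a := a) (b := T)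
    (f := fun b => -Real.exp (-(2 * β * b))) (f' := fun b => 2 * β * Real.exp (-(2 * β * b)))
    (fun b _ => by
      have h := (((hasDerivAt_id b).const_mul (2 * β)).neg.exp).neg
      refine (h.congr_deriv ?_)
      simp [mul_comm])
    ((by fun_prop : Continuous fun b => 2 * β * Real.exp (-(2 * β * b))).intervalIntegrable _ _)
  rw [this]; ring

/-- Formally `⟨U, ∫U⟩` is half the derivative of `‖∫U‖²`; integrating by parts against the weight
produces the left side plus a nonnegative boundary term at `T`, which is dropped. The sign of `β`
plays no role. -/
theorem energy_primitive [CompleteSpace H] {T β : ℝ} (hT : 0 ≤ T) {U : ℝ → H}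
    (hU : IntervalIntegrable U volume 0 T) :
    β * ∫ t in 0..T, Real.exp (-(2 * β * t)) * ‖∫ s in 0..t, U s‖ ^ 2 ≤
      ∫ t in 0..T, Real.exp (-(2 * β * t)) * inner ℝ (U t) (∫ s in 0..t, U s) := by
  have hh := intervalIntegrable_inner_primitive hT hU
  set h : ℝ → ℝ := fun a => inner ℝ (U a) (∫ b in 0..a, U b) with hh_def
  have hc : Continuous fun b => 2 * β * Real.exp (-(2 * β * b)) := by fun_prop
  have hsq : ∀ t ∈ Icc 0 T, ‖∫ s in 0..t, U s‖ ^ 2 = 2 * ∫ a in 0..t, h a := fun t ht =>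
    norm_sq_primitive ht.1 (hU.mono_set (by
      rw [uIcc_of_le ht.1, uIcc_of_le hT]; exact Icc_subset_Icc_right ht.2))
  have key := integral_smul_primitive hT (hc.intervalIntegrable 0 T) hh
  simp only [integral_exp_weight, smul_eq_mul] at key
  have h1 : ∫ b in 0..T, 2 * β * Real.exp (-(2 * β * b)) * ∫ a in 0..b, h a =
      β * ∫ t in 0..T, Real.exp (-(2 * β * t)) * ‖∫ s in 0..t, U s‖ ^ 2 := by
    rw [← intervalIntegral.integral_const_mul]
    refine intervalIntegral.integral_congr fun t ht => ?_
    rw [uIcc_of_le hT] at ht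
    simp only [hsq t ht]
    ring
  have hc' : Continuous fun b => Real.exp (-(2 * β * b)) := by fun_prop
  have h2 : ∫ a in 0..T, (Real.exp (-(2 * β * a)) - Real.exp (-(2 * β * T))) * h a =
      (∫ a in 0..T, Real.exp (-(2 * β * a)) * h a) - Real.exp (-(2 * β * T)) * ∫ a in 0..T, h a := by
    rw [← intervalIntegral.integral_const_mul, ← intervalIntegral.integral_sub
      (hh.continuousOn_mul hc'.continuousOn) (hh.const_mul _)]
    simp only [sub_mul]
  rw [← h1, key, h2]
  have h3 : 0 ≤ ∫ a in 0..T, h a := by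
    have := hsq T ⟨hT, le_rfl⟩
    nlinarith [sq_nonneg ‖∫ s in 0..T, U s‖]
  have := mul_nonneg (Real.exp_pos (-(2 * β * T))).le h3
  linarith

/-- The solution `y` of `y' + r y = u`, `y(0) = 0`. -/
noncomputable def expConv (r : ℝ) (u : ℝ → H) (t : ℝ) : H :=
  ∫ s in 0..t, Real.exp (-(r * (t - s))) • u s

theorem expConv_eq (r : ℝ) (u : ℝ → H) (t : ℝ) :
    expConv r u t = Real.exp (-(r * t)) • ∫ s in 0..t, Real.exp (r * s) • u s := by
  rw [expConv, ← intervalIntegral.integral_smul]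
  refine intervalIntegral.integral_congr fun s _ => ?_
  simp only [smul_smul, ← Real.exp_add]
  ring_nf

/-- The integrating factor `exp (r s)` turns `expConv r u` into a plain primitive, and shifts the
weight exponent from `l` to `r + l`. -/
theorem energy_expConv [CompleteSpace H] {T r l : ℝ} (hT : 0 ≤ T) {u : ℝ → H}
    (hu : IntervalIntegrable u volume 0 T) :
    (r + l) * ∫ t in 0..T, Real.exp (-(2 * l * t)) * ‖expConv r u t‖ ^ 2 ≤
      ∫ t in 0..T, Real.exp (-(2 * l * t)) * inner ℝ (u t) (expConv r u t) := by
  have hU : IntervalIntegrable (fun s => Real.exp (r * s) • u s) volume 0 T :=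
    hu.continuousOn_smul (by fun_prop)
  convert energy_primitive (β := r + l) hT hU using 2
  · refine intervalIntegral.integral_congr fun t _ => ?_
    simp only [expConv_eq, norm_smul, Real.norm_eq_abs, Real.abs_exp, mul_pow, ← mul_assoc,
      ← Real.exp_nat_mul, ← Real.exp_add]
    congr 2
    push_cast
    ring
  · ext t
    simp only [expConv_eq, inner_smul_right, inner_smul_left, ← mul_assoc, ← Real.exp_add,
      RCLike.conj_to_real]
    congr 2
    ring

/-- This is `y' + r y = u` integrated from `0` to `t`. -/
theorem primitive_eq_expConv_add [CompleteSpace H] {t : ℝ} (r : ℝ) (ht : 0 ≤ t) {u : ℝ → H}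
    (hu : IntervalIntegrable u volume 0 t) :
    ∫ s in 0..t, u s = expConv r u t + r • ∫ s in 0..t, expConv r u s := by
  have hU : IntervalIntegrable (fun s => Real.exp (r * s) • u s) volume 0 t :=
    hu.continuousOn_smul (by fun_prop)
  have hc : Continuous fun b => r * Real.exp (-(r * b)) := by fun_prop
  have key := integral_smul_primitive ht (hc.intervalIntegrable 0 t) hU
  have hw : ∀ a, ∫ b in a..t, r * Real.exp (-(r * b)) =
      Real.exp (-(r * a)) - Real.exp (-(r * t)) := fun a => by
    have := integral_exp_weight (r / 2) a t
    simpa [mul_div_cancel₀] using this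
  simp only [hw, smul_smul, sub_mul, ← Real.exp_add] at key
  rw [expConv, ← intervalIntegral.integral_smul, intervalIntegral.integral_congr
    (f := fun s => r • expConv r u s)
    (g := fun b => (r * Real.exp (-(r * b))) • ∫ a in 0..b, Real.exp (r * a) • u a)
    (fun s _ => by simp only [expConv_eq, smul_smul]), key,
    ← intervalIntegral.integral_add (hu.continuousOn_smul (by fun_prop))
      (hu.continuousOn_smul (by fun_prop))]
  refine intervalIntegral.integral_congr fun s _ => ?_
  simp only [← add_smul]
  rw [show -(r * (t - s)) = -(r * t) + r * s by ring, neg_add_cancel, Real.exp_zero]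
  simp

end Energy

/-! ### The kernel `ω_α` as a Laplace transform -/

section Kernel

/-- The measure whose Laplace transform is the kernel `ω_α`, for `0 < α < 1`. -/
noncomputable def kernelMeasure (α : ℝ) : Measure ℝ :=
  (volume.restrict (Ioi 0)).withDensity
    fun r => ENNReal.ofReal (r ^ (-α) / (Real.Gamma α * Real.Gamma (1 - α)))

noncomputable instance (α : ℝ) : SFinite (kernelMeasure α) := by
  unfold kernelMeasure; infer_instance

variable {α : ℝ}

theorem kernelDensity_nonneg (hα : α ∈ Ioo (0 : ℝ) 1) {r : ℝ} (hr : 0 < r) :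
    0 ≤ r ^ (-α) / (Real.Gamma α * Real.Gamma (1 - α)) := by
  have h1 := Real.Gamma_pos_of_pos hα.1
  have h2 := Real.Gamma_pos_of_pos (sub_pos.2 hα.2)
  positivity

theorem measurable_kernelDensity (α : ℝ) :
    Measurable fun r : ℝ => ENNReal.ofReal (r ^ (-α) / (Real.Gamma α * Real.Gamma (1 - α))) := by
  fun_prop

theorem integrable_kernelMeasure_iff (hα : α ∈ Ioo (0 : ℝ) 1) {g : ℝ → ℝ} :
    Integrable g (kernelMeasure α) ↔ IntegrableOn
      (fun r => r ^ (-α) / (Real.Gamma α * Real.Gamma (1 - α)) * g r) (Ioi 0) := by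
  rw [kernelMeasure, integrable_withDensity_iff_integrable_smul' (measurable_kernelDensity α)
    (by simp), IntegrableOn]
  refine integrable_congr ?_
  filter_upwards [ae_restrict_mem measurableSet_Ioi] with r hr
  rw [ENNReal.toReal_ofReal (kernelDensity_nonneg hα hr), smul_eq_mul]

theorem integral_kernelMeasure (hα : α ∈ Ioo (0 : ℝ) 1) (g : ℝ → ℝ) :
    ∫ r, g r ∂(kernelMeasure α) =
      ∫ r in Ioi 0, r ^ (-α) / (Real.Gamma α * Real.Gamma (1 - α)) * g r := by
  rw [kernelMeasure, integral_withDensity_eq_integral_toReal_smul (measurable_kernelDensity α)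
    (by simp)]
  refine setIntegral_congr_fun measurableSet_Ioi fun r hr => ?_
  rw [ENNReal.toReal_ofReal (kernelDensity_nonneg hα hr), smul_eq_mul]

theorem ae_pos_kernelMeasure (α : ℝ) : ∀ᵐ r ∂(kernelMeasure α), 0 < r :=
  (withDensity_absolutelyContinuous _ _).ae_le (ae_restrict_mem measurableSet_Ioi)

/-- The Gamma integral gives `Γ(1 - α) τ^(α-1)`, and the normalisation of the density leaves `1 /
Γ(α)`. -/
theorem integral_exp_kernelMeasure (hα : α ∈ Ioo (0 : ℝ) 1) {τ : ℝ} (hτ : 0 < τ) :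
    ∫ r, Real.exp (-(r * τ)) ∂(kernelMeasure α) = omega α τ := by
  have h := Real.integral_rpow_mul_exp_neg_mul_Ioi (sub_pos.2 hα.2) hτ
  have h1 := (Real.Gamma_pos_of_pos hα.1).ne'
  have h2 := (Real.Gamma_pos_of_pos (sub_pos.2 hα.2)).ne'
  rw [integral_kernelMeasure hα, omega]
  have : ∀ r : ℝ, r ^ (-α) / (Real.Gamma α * Real.Gamma (1 - α)) * Real.exp (-(r * τ)) =
      (Real.Gamma α * Real.Gamma (1 - α))⁻¹ * (r ^ (1 - α - 1) * Real.exp (-(τ * r))) := fun r => by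
    rw [show 1 - α - 1 = -α by ring, mul_comm r τ]; ring
  simp only [this, integral_const_mul, h]
  rw [one_div, Real.inv_rpow hτ.le, ← Real.rpow_neg hτ.le, neg_sub]
  field_simp

theorem omega_pos (hα : α ∈ Ioo (0 : ℝ) 1) {τ : ℝ} (hτ : 0 < τ) : 0 < omega α τ :=
  div_pos (Real.rpow_pos_of_pos hτ _) (Real.Gamma_pos_of_pos hα.1)

theorem integrable_exp_kernelMeasure (hα : α ∈ Ioo (0 : ℝ) 1) {τ : ℝ} (hτ : 0 < τ) :
    Integrable (fun r => Real.exp (-(r * τ))) (kernelMeasure α) := by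
  -- A non-integrable function has Bochner integral `0`, whereas this one has integral `ω_α(τ) > 0`.
  by_contra h
  have := integral_undef h
  rw [integral_exp_kernelMeasure hα hτ] at this
  exact (omega_pos hα hτ).ne' this

/-- Near `0` the density `r^(-α)` is integrable since `α < 1`; at infinity the integrand is at most
of order `r^(-α-1)`, integrable since `α > 0`. -/
theorem integrable_inv_kernelMeasure (hα : α ∈ Ioo (0 : ℝ) 1) :
    Integrable (fun r => (r + 1)⁻¹) (kernelMeasure α) := by
  rw [integrable_kernelMeasure_iff hα, ← Ioc_union_Ioi_eq_Ioi (zero_le_one (α := ℝ))]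
  have hm : Measurable fun r : ℝ =>
      r ^ (-α) / (Real.Gamma α * Real.Gamma (1 - α)) * (r + 1)⁻¹ := by fun_prop
  have hG := mul_pos (Real.Gamma_pos_of_pos hα.1) (Real.Gamma_pos_of_pos (sub_pos.2 hα.2))
  refine IntegrableOn.union ?_ ?_
  · have h0 : IntegrableOn (fun r : ℝ => r ^ (-α)) (Ioc 0 1) :=
      (intervalIntegral.intervalIntegrable_rpow' (by linarith [hα.2])).1
    refine (h0.div_const (Real.Gamma α * Real.Gamma (1 - α))).mono hm.aestronglyMeasurable ?_
    filter_upwards [ae_restrict_mem measurableSet_Ioc] with r hr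
    rw [norm_mul]
    refine mul_le_of_le_one_right (norm_nonneg _) ?_
    rw [norm_inv, Real.norm_eq_abs, abs_of_pos (by linarith [hr.1])]
    exact inv_le_one_of_one_le₀ (by linarith [hr.1])
  · have h0 : IntegrableOn (fun r : ℝ => r ^ (-α - 1)) (Ioi 1) :=
      integrableOn_Ioi_rpow_of_lt (by linarith [hα.1]) one_pos
    refine (h0.div_const (Real.Gamma α * Real.Gamma (1 - α))).mono hm.aestronglyMeasurable ?_
    filter_upwards [ae_restrict_mem measurableSet_Ioi] with r hr
    have hr0 : (0 : ℝ) < r := one_pos.trans hr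
    rw [Real.rpow_sub hr0, Real.rpow_one, Real.norm_eq_abs, Real.norm_eq_abs,
      abs_of_nonneg (by positivity), abs_of_nonneg (by positivity)]
    have : (r + 1)⁻¹ ≤ r⁻¹ := inv_anti₀ hr0 (by linarith)
    calc _ ≤ r ^ (-α) / (Real.Gamma α * Real.Gamma (1 - α)) * r⁻¹ := by gcongr
      _ = _ := by field_simp

theorem tendsto_integral_inv_kernelMeasure (hα : α ∈ Ioo (0 : ℝ) 1) :
    Filter.Tendsto (fun l : ℝ => ∫ r, (r + l)⁻¹ ∂(kernelMeasure α)) Filter.atTop (nhds 0) := by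
  rw [← integral_zero ℝ ℝ (μ := kernelMeasure α)]
  refine tendsto_integral_filter_of_dominated_convergence _ ?_ ?_
    (integrable_inv_kernelMeasure hα) ?_
  · exact Filter.Eventually.of_forall fun l =>
      (by fun_prop : Measurable fun r : ℝ => (r + l)⁻¹).aestronglyMeasurable
  · filter_upwards [Filter.eventually_ge_atTop 1] with l hl
    filter_upwards [ae_pos_kernelMeasure α] with r hr
    rw [norm_inv, Real.norm_eq_abs, abs_of_pos (by linarith)]
    exact inv_anti₀ (by linarith) (by linarith)
  · exact Filter.Eventually.of_forall fun r =>
      tendsto_inv_atTop_zero.comp (Filter.tendsto_atTop_add_const_left _ r Filter.tendsto_id)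

theorem kernelMeasure_Ioc_ne_zero (hα : α ∈ Ioo (0 : ℝ) 1) : kernelMeasure α (Ioc 0 1) ≠ 0 := by
  rw [kernelMeasure, withDensity_apply _ measurableSet_Ioc, Measure.restrict_restrict
    measurableSet_Ioc, inter_eq_self_of_subset_left Ioc_subset_Ioi_self]
  intro h
  rw [lintegral_eq_zero_iff (measurable_kernelDensity α)] at h
  have h1 := Real.Gamma_pos_of_pos hα.1
  have h2 := Real.Gamma_pos_of_pos (sub_pos.2 hα.2)
  have : ∀ᵐ r ∂(volume.restrict (Ioc (0 : ℝ) 1)), False := by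
    filter_upwards [h, ae_restrict_mem measurableSet_Ioc] with r hr hr'
    have := hr'.1
    simp only [Pi.zero_apply, ENNReal.ofReal_eq_zero] at hr
    exact absurd hr (not_le.2 (by positivity))
  rw [ae_iff] at this
  simp at this

/-- Markov's inequality for the integrable function `exp (-r)`, which is at least `exp (-1)` on
`(0,1]`. -/
theorem kernelMeasure_Ioc_ne_top (hα : α ∈ Ioo (0 : ℝ) 1) : kernelMeasure α (Ioc 0 1) ≠ ⊤ := by
  have h := (integrable_exp_kernelMeasure hα one_pos).measure_norm_ge_lt_top (Real.exp_pos (-1))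
  refine ((measure_mono fun r hr => ?_).trans_lt h).ne
  simpa using hr.2

theorem intervalIntegrable_omega (hα : α ∈ Ioo (0 : ℝ) 1) (T : ℝ) :
    IntervalIntegrable (omega α) volume 0 T :=
  (intervalIntegral.intervalIntegrable_rpow' (by linarith [hα.1])).div_const _

end Kernel

/-! ### Primitives in exponentially weighted norms -/

section Weighted

theorem sq_integral_le {t : ℝ} (ht : 0 ≤ t) {g : ℝ → ℝ} (hg : IntervalIntegrable g volume 0 t)
    (hg2 : IntervalIntegrable (fun s => g s ^ 2) volume 0 t) :
    (∫ s in 0..t, g s) ^ 2 ≤ t * ∫ s in 0..t, g s ^ 2 := by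
  rcases ht.eq_or_lt with rfl | ht'
  · simp
  set c := ∫ s in 0..t, g s with hc
  -- Jensen's inequality as nonnegativity of the variance; `c / t` is the mean of `g`.
  have h0 : 0 ≤ ∫ s in 0..t, (g s - c / t) ^ 2 :=
    intervalIntegral.integral_nonneg ht fun s _ => sq_nonneg _
  have h1 : ∫ s in 0..t, (g s - c / t) ^ 2 = (∫ s in 0..t, g s ^ 2) - c ^ 2 / t := by
    have : ∀ s, (g s - c / t) ^ 2 = g s ^ 2 - (2 * (c / t)) * g s + (c / t) ^ 2 := fun s => by ring
    simp only [this]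
    rw [intervalIntegral.integral_add (hg2.sub (hg.const_mul _)) (by simp),
      intervalIntegral.integral_sub hg2 (hg.const_mul _), intervalIntegral.integral_const_mul, ← hc]
    simp
    field_simp
    ring
  rw [h1] at h0
  have h2 : c ^ 2 / t ≤ ∫ s in 0..t, g s ^ 2 := by linarith
  rwa [div_le_iff₀ ht', mul_comm] at h2

/-- Since `l ≥ 0`, the weight at `t` is at most the weight at any `s ≤ t` and can be moved inside.
The constant `T ^ 2` does not depend on `l`, so `l` may be chosen after it. -/
theorem integral_exp_sq_primitive_le {T l : ℝ} (hT : 0 ≤ T) (hl : 0 ≤ l) {g : ℝ → ℝ}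
    (hg : IntervalIntegrable g volume 0 T)
    (hg2 : IntervalIntegrable (fun s => g s ^ 2) volume 0 T) :
    ∫ t in 0..T, Real.exp (-(2 * l * t)) * (∫ s in 0..t, g s) ^ 2 ≤
      T ^ 2 * ∫ t in 0..T, Real.exp (-(2 * l * t)) * g t ^ 2 := by
  have hc' : Continuous fun b => Real.exp (-(2 * l * b)) := by fun_prop
  have hwi := hg2.continuousOn_mul hc'.continuousOn
  have hcont : ContinuousOn (fun a => ∫ b in 0..a, g b) (uIcc 0 T) :=
    intervalIntegral.continuousOn_primitive_interval' hg left_mem_uIcc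
  have hb : ∀ t ∈ Icc 0 T, Real.exp (-(2 * l * t)) * (∫ s in 0..t, g s) ^ 2 ≤
      T * ∫ s in 0..T, Real.exp (-(2 * l * s)) * g s ^ 2 := by
    intro t ht
    have hsub : uIcc 0 t ⊆ uIcc 0 T := by
      rw [uIcc_of_le ht.1, uIcc_of_le hT]; exact Icc_subset_Icc_right ht.2
    calc Real.exp (-(2 * l * t)) * (∫ s in 0..t, g s) ^ 2
        ≤ Real.exp (-(2 * l * t)) * (t * ∫ s in 0..t, g s ^ 2) :=
          mul_le_mul_of_nonneg_left (sq_integral_le ht.1 (hg.mono_set hsub) (hg2.mono_set hsub))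
            (Real.exp_pos _).le
      _ = t * ∫ s in 0..t, Real.exp (-(2 * l * t)) * g s ^ 2 := by
          rw [intervalIntegral.integral_const_mul]; ring
      _ ≤ t * ∫ s in 0..t, Real.exp (-(2 * l * s)) * g s ^ 2 := by
          refine mul_le_mul_of_nonneg_left (intervalIntegral.integral_mono_on ht.1
            ((hg2.mono_set hsub).const_mul _) (hwi.mono_set hsub) fun s hs => ?_) ht.1
          have : 2 * l * s ≤ 2 * l * t := by gcongr; exact hs.2
          gcongr
      _ ≤ T * ∫ s in 0..T, Real.exp (-(2 * l * s)) * g s ^ 2 := by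
          refine mul_le_mul ht.2 ?_ (intervalIntegral.integral_nonneg ht.1 fun s _ => by positivity)
            hT
          exact intervalIntegral.integral_mono_interval le_rfl ht.1 ht.2
            (Filter.Eventually.of_forall fun s => by positivity) hwi
  calc _ ≤ ∫ t in 0..T, T * ∫ s in 0..T, Real.exp (-(2 * l * s)) * g s ^ 2 :=
        intervalIntegral.integral_mono_on hT
          (hc'.continuousOn.mul (hcont.pow 2)).intervalIntegrable (by simp) hb
    _ = _ := by simp; ring

end Weighted

/-! ### The fractional integral as a superposition of exponential convolutions -/

section Representation

variable {H : Type} [NormedAddCommGroup H] [InnerProductSpace ℝ H] {α : ℝ}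

theorem continuousOn_expConv {T r : ℝ} {u : ℝ → H} (hu : IntervalIntegrable u volume 0 T) :
    ContinuousOn (expConv r u) (uIcc 0 T) := by
  have hU : IntervalIntegrable (fun s => Real.exp (r * s) • u s) volume 0 T :=
    hu.continuousOn_smul (by fun_prop)
  refine ContinuousOn.congr (f := fun t => Real.exp (-(r * t)) • ∫ s in 0..t, Real.exp (r * s) • u s)
    ?_ fun t _ => expConv_eq r u t
  exact (by fun_prop : Continuous fun t => Real.exp (-(r * t))).continuousOn.smul
    (intervalIntegral.continuousOn_primitive_interval' hU left_mem_uIcc)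

/-- The representation of the fractional integral as a superposition of exponential
convolutions. -/
theorem fracInt_eq_integral_expConv [CompleteSpace H]
    (hα : α ∈ Ioo (0 : ℝ) 1) {t : ℝ} (ht : 0 ≤ t) {u : ℝ → H}
    (hum : AEStronglyMeasurable u (volume.restrict (Ioc 0 t)))
    (hu : IntervalIntegrable (fun s => omega α (t - s) • u s) volume 0 t) :
    Integrable (fun r => expConv r u t) (kernelMeasure α) ∧
      ∫ r, expConv r u t ∂(kernelMeasure α) = fracInt α u t := by
  have hlt : ∀ᵐ s ∂(volume.restrict (Ioc 0 t)), 0 < t - s := by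
    rw [← Measure.restrict_congr_set Ioo_ae_eq_Ioc]
    filter_upwards [ae_restrict_mem measurableSet_Ioo] with s hs
    linarith [hs.2]
  have hF : Integrable (Function.uncurry fun s r => Real.exp (-(r * (t - s))) • u s)
      ((volume.restrict (Ioc 0 t)).prod (kernelMeasure α)) := by
    have hm : Measurable fun p : ℝ × ℝ => Real.exp (-(p.2 * (t - p.1))) := by fun_prop
    have hFm : AEStronglyMeasurable (Function.uncurry fun s r => Real.exp (-(r * (t - s))) • u s)
        ((volume.restrict (Ioc 0 t)).prod (kernelMeasure α)) :=
      hm.aestronglyMeasurable.smul hum.comp_fst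
    rw [integrable_prod_iff hFm]
    refine ⟨?_, ?_⟩
    · filter_upwards [hlt] with s hs
      exact (integrable_exp_kernelMeasure hα hs).smul_const (u s)
    · refine hu.1.norm.congr ?_
      filter_upwards [hlt] with s hs
      simp only [Function.uncurry, norm_smul, Real.norm_eq_abs, Real.abs_exp, integral_mul_const]
      rw [integral_exp_kernelMeasure hα hs, abs_of_pos (omega_pos hα hs)]
  have hswap := integral_integral_swap hF
  simp only [expConv, intervalIntegral.integral_of_le ht, fracInt]
  refine ⟨hF.integral_prod_right, ?_⟩
  rw [← hswap]
  refine integral_congr_ae ?_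
  filter_upwards [hlt] with s hs
  rw [integral_smul_const, integral_exp_kernelMeasure hα hs]

end Representation

/-! ### Coercivity of the fractional integral -/

section Coercivity

variable {H : Type} [NormedAddCommGroup H] [InnerProductSpace ℝ H] {α : ℝ}

/-- The quadratic polynomial `y ↦ ∫ ρ (g - y / ρ)²` is nonnegative, so its discriminant is not
positive. -/
theorem sq_integral_le_weighted {X : Type*} [MeasurableSpace X] {μ : Measure X} {ρ g : X → ℝ}
    (hρ : ∀ᵐ x ∂μ, 0 < ρ x) (hρi : Integrable (fun x => (ρ x)⁻¹) μ) (hg : Integrable g μ)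
    (hg2 : Integrable (fun x => ρ x * g x ^ 2) μ) :
    (∫ x, g x ∂μ) ^ 2 ≤ (∫ x, (ρ x)⁻¹ ∂μ) * ∫ x, ρ x * g x ^ 2 ∂μ := by
  have h : ∀ y : ℝ, 0 ≤ (∫ x, (ρ x)⁻¹ ∂μ) * (y * y) + (-(2 * ∫ x, g x ∂μ)) * y +
      ∫ x, ρ x * g x ^ 2 ∂μ := by
    intro y
    have h0 : 0 ≤ ∫ x, ((ρ x)⁻¹ * (y * y) + (-(2 * y)) * g x + ρ x * g x ^ 2) ∂μ := by
      refine integral_nonneg_of_ae ?_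
      filter_upwards [hρ] with x hx
      have : (ρ x)⁻¹ * (y * y) + (-(2 * y)) * g x + ρ x * g x ^ 2 =
          ρ x * (g x - y * (ρ x)⁻¹) ^ 2 := by field_simp; ring
      simp only [Pi.zero_apply, this]
      positivity
    have hi : Integrable (fun x => (ρ x)⁻¹ * (y * y) + (-(2 * y)) * g x) μ :=
      (hρi.mul_const _).add (hg.const_mul _)
    rw [integral_add hi hg2,
      integral_add (hρi.mul_const _) (hg.const_mul _), integral_mul_const, integral_const_mul] at h0
    linarith
  have := discrim_le_zero h
  rw [discrim] at this
  nlinarith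

/-- Schur's test for the fractional integral kernel. -/
theorem integrable_norm_mul_fracInt_norm {H : Type} [NormedAddCommGroup H] (hα : α ∈ Ioo (0 : ℝ) 1) {T : ℝ} {u : ℝ → H}
    (hu : MemLp u 2 (volume.restrict (Ioc 0 T))) :
    Integrable (fun t => ‖u t‖ * fracInt α (fun s => ‖u s‖) t) (volume.restrict (Ioc 0 T)) := by
  set m := volume.restrict (Ioc (0 : ℝ) T) with hm
  set K : ℝ → ℝ := (Ioc 0 T).indicator (omega α) with hK
  set f : ℝ → ℝ := (Ioc 0 T).indicator (fun s => ‖u s‖ ^ 2) with hf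
  have hKm : Measurable K := by
    refine Measurable.indicator ?_ measurableSet_Ioc
    unfold omega; fun_prop
  have hKi : Integrable K := (intervalIntegrable_omega hα T).1.integrable_indicator measurableSet_Ioc
  have hfi : Integrable f :=
    IntegrableOn.integrable_indicator (hu.norm.integrable_sq) measurableSet_Ioc
  have hK0 : ∀ τ, 0 ≤ K τ := fun τ => indicator_nonneg (fun τ hτ => (omega_pos hα hτ.1).le) τ
  have h1 : Integrable (fun p : ℝ × ℝ => f p.2 * K (p.1 - p.2)) (volume.prod volume) :=
    hfi.convolution_integrand (ContinuousLinearMap.mul ℝ ℝ) hKi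
  have h2 : Integrable (fun p : ℝ × ℝ => f p.1 * K (p.1 - p.2)) (volume.prod volume) := by
    have := (hfi.convolution_integrand (ContinuousLinearMap.mul ℝ ℝ) hKi.comp_neg).swap
    refine this.congr (Filter.Eventually.of_forall fun p => ?_)
    simp
  -- The product `‖u t‖ ‖u s‖` is dominated by `‖u t‖² + ‖u s‖²`; each resulting term is an
  -- integrand of the convolution of two `L_1` functions, with the kernel reflected in one case.
  have hS : Integrable (fun p : ℝ × ℝ => K (p.1 - p.2) * (‖u p.1‖ * ‖u p.2‖)) (m.prod m) := by
    have h3 : Integrable (fun p : ℝ × ℝ => f p.2 * K (p.1 - p.2) + f p.1 * K (p.1 - p.2))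
        (m.prod m) := by
      rw [hm, Measure.prod_restrict]
      exact (h1.add h2).restrict
    refine h3.mono ((hKm.comp (measurable_fst.sub measurable_snd)).aestronglyMeasurable.mul
      (hu.1.norm.comp_fst.mul hu.1.norm.comp_snd)) ?_
    have hmem : ∀ᵐ p ∂(m.prod m), p ∈ Ioc 0 T ×ˢ Ioc 0 T := by
      rw [hm, Measure.prod_restrict]
      exact ae_restrict_mem (measurableSet_Ioc.prod measurableSet_Ioc)
    filter_upwards [hmem] with p hp
    have e1 : f p.1 = ‖u p.1‖ ^ 2 := indicator_of_mem hp.1 _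
    have e2 : f p.2 = ‖u p.2‖ ^ 2 := indicator_of_mem hp.2 _
    have hk := hK0 (p.1 - p.2)
    rw [e1, e2, Real.norm_eq_abs, Real.norm_eq_abs, abs_of_nonneg (by positivity),
      abs_of_nonneg (by positivity)]
    nlinarith [mul_nonneg hk (sq_nonneg (‖u p.1‖ - ‖u p.2‖)), mul_nonneg hk (sq_nonneg ‖u p.1‖),
      mul_nonneg hk (sq_nonneg ‖u p.2‖)]
  refine hS.integral_prod_left.congr ?_
  filter_upwards [ae_restrict_mem measurableSet_Ioc] with t ht
  rw [fracInt, intervalIntegral.integral_of_le ht.1.le,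
    integral_Ioc_eq_integral_Ioo (y := t),
    ← integral_const_mul, ← integral_indicator measurableSet_Ioc,
    ← integral_indicator measurableSet_Ioo]
  congr 1
  ext s
  have := ht.2
  simp only [hK, indicator, mem_Ioc, mem_Ioo, smul_eq_mul]
  split_ifs <;> first | (exfalso; grind) | ring

theorem aestronglyMeasurable_expConv {T : ℝ} {u : ℝ → H} (ν : Measure ℝ) [SFinite ν]
    (hu : AEStronglyMeasurable u (volume.restrict (Ioc 0 T))) :
    AEStronglyMeasurable (fun p : ℝ × ℝ => expConv p.2 u p.1)
      ((volume.restrict (Ioc 0 T)).prod ν) := by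
  set m := volume.restrict (Ioc (0 : ℝ) T) with hm
  -- The variable upper limit becomes an indicator, so `expConv` is a parameter integral over a
  -- fixed measure.
  have hk : Measurable fun q : (ℝ × ℝ) × ℝ =>
      {q : (ℝ × ℝ) × ℝ | q.2 ≤ q.1.1}.indicator
        (fun q => Real.exp (-(q.1.2 * (q.1.1 - q.2)))) q :=
    Measurable.indicator (by fun_prop)
      (measurableSet_le measurable_snd (measurable_fst.comp measurable_fst))
  have h := (hk.aestronglyMeasurable (μ := (m.prod ν).prod m)).smul hu.comp_snd
  refine h.integral_prod_right'.congr ?_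
  have hmem : ∀ᵐ p ∂(m.prod ν), p.1 ∈ Ioc 0 T :=
    Measure.quasiMeasurePreserving_fst.ae (ae_restrict_mem measurableSet_Ioc)
  filter_upwards [hmem] with p hp
  rw [expConv, intervalIntegral.integral_of_le hp.1.le, ← integral_indicator measurableSet_Ioc,
    ← integral_indicator measurableSet_Ioc]
  congr 1
  ext s
  have := hp.2
  simp only [indicator, mem_Ioc, mem_ofPred_eq, Pi.smul_apply']
  split_ifs <;> first | (exfalso; grind) | simp

theorem norm_expConv_le {r t : ℝ} (ht : 0 ≤ t) (u : ℝ → H) :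
    ‖expConv r u t‖ ≤ expConv r (fun s => ‖u s‖) t := by
  refine (intervalIntegral.norm_integral_le_integral_norm ht).trans_eq ?_
  simp [expConv, norm_smul]

/-- This licenses Fubini in `(t, r)`. Integrating the absolute value in `r` first gives at most `‖u
t‖ I^α‖u‖(t)`, because the representation formula also applies to `‖u‖`; Schur's test finishes. -/
theorem integrable_inner_expConv [CompleteSpace H] (hα : α ∈ Ioo (0 : ℝ) 1) {T l : ℝ} (hl : 0 ≤ l)
    {u : ℝ → H} (hu : MemLp u 2 (volume.restrict (Ioc 0 T)))
    (hi : ∀ᵐ t ∂(volume.restrict (Ioc 0 T)),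
      IntervalIntegrable (fun s => omega α (t - s) • u s) volume 0 t) :
    Integrable (fun p : ℝ × ℝ => Real.exp (-(2 * l * p.1)) * inner ℝ (u p.1) (expConv p.2 u p.1))
      ((volume.restrict (Ioc 0 T)).prod (kernelMeasure α)) := by
  have hmeas : AEStronglyMeasurable
      (fun p : ℝ × ℝ => Real.exp (-(2 * l * p.1)) * inner ℝ (u p.1) (expConv p.2 u p.1))
      ((volume.restrict (Ioc 0 T)).prod (kernelMeasure α)) :=
    (by fun_prop : Measurable fun p : ℝ × ℝ => Real.exp (-(2 * l * p.1))).aestronglyMeasurable.mul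
      (hu.1.comp_fst.inner (aestronglyMeasurable_expConv _ hu.1))
  rw [integrable_prod_iff hmeas]
  have hsub : ∀ t ∈ Ioc 0 T, AEStronglyMeasurable u (volume.restrict (Ioc 0 t)) := fun t ht =>
    hu.1.mono_measure (Measure.restrict_mono_set _ (Ioc_subset_Ioc_right ht.2))
  refine ⟨?_, ?_⟩
  · filter_upwards [hi, ae_restrict_mem measurableSet_Ioc] with t hit ht
    exact ((fracInt_eq_integral_expConv hα ht.1.le (hsub t ht) hit).1.const_inner (u t)).const_mul _
  · refine (integrable_norm_mul_fracInt_norm hα hu).mono hmeas.norm.integral_prod_right' ?_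
    filter_upwards [hi, ae_restrict_mem measurableSet_Ioc] with t hit ht
    have hlt : ∀ᵐ s ∂(volume.restrict (Ioc 0 t)), 0 < t - s := by
      rw [← Measure.restrict_congr_set Ioo_ae_eq_Ioc]
      filter_upwards [ae_restrict_mem measurableSet_Ioo] with s hs
      linarith [hs.2]
    have hit' : IntervalIntegrable (fun s => omega α (t - s) • ‖u s‖) volume 0 t := by
      rw [intervalIntegrable_iff_integrableOn_Ioc_of_le ht.1.le]
      refine hit.1.norm.congr ?_
      filter_upwards [hlt] with s hs
      rw [norm_smul, Real.norm_eq_abs, abs_of_pos (omega_pos hα hs), smul_eq_mul]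
    have hn := fracInt_eq_integral_expConv hα ht.1.le (hsub t ht).norm hit'
    rw [← hn.2, ← integral_const_mul]
    refine (norm_integral_le_integral_norm _).trans ((integral_mono_of_nonneg
      (Filter.Eventually.of_forall fun r => norm_nonneg _) (hn.1.const_mul _)
      (Filter.Eventually.of_forall fun r => ?_)).trans (le_abs_self _))
    simp only [norm_mul, Real.norm_eq_abs, Real.abs_exp, abs_abs]
    have h1 : Real.exp (-(2 * l * t)) ≤ 1 := by
      rw [Real.exp_le_one_iff]
      have := mul_nonneg hl ht.1.le
      linarith
    refine (mul_le_of_le_one_left (abs_nonneg _) h1).trans ((abs_real_inner_le_norm _ _).trans ?_)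
    exact mul_le_mul_of_nonneg_left (norm_expConv_le ht.1.le u) (norm_nonneg _)

/-- The quadratic form of the fractional integral, in an exponentially weighted norm, controls the
superposition of the energies of the exponential convolutions. -/
theorem integral_energy_le [CompleteSpace H] (hα : α ∈ Ioo (0 : ℝ) 1) {T l : ℝ} (hT : 0 ≤ T)
    (hl : 0 ≤ l) {u : ℝ → H} (hu : MemLp u 2 (volume.restrict (Ioc 0 T)))
    (hi : ∀ᵐ t ∂(volume.restrict (Ioc 0 T)),
      IntervalIntegrable (fun s => omega α (t - s) • u s) volume 0 t) :
    Integrable (fun p : ℝ × ℝ =>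
        (p.2 + l) * (Real.exp (-(2 * l * p.1)) * ‖expConv p.2 u p.1‖ ^ 2))
      ((volume.restrict (Ioc 0 T)).prod (kernelMeasure α)) ∧
    ∫ r, (r + l) * (∫ t in 0..T, Real.exp (-(2 * l * t)) * ‖expConv r u t‖ ^ 2)
        ∂(kernelMeasure α) ≤
      ∫ t in 0..T, Real.exp (-(2 * l * t)) * inner ℝ (u t) (fracInt α u t) := by
  have hu1 : IntervalIntegrable u volume 0 T := by
    rw [intervalIntegrable_iff_integrableOn_Ioc_of_le hT]
    exact hu.integrable one_le_two
  have hI := integrable_inner_expConv hα hl hu hi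
  have hΦ := hI.integral_prod_right
  have hen : ∀ r : ℝ, (r + l) * ∫ t in 0..T, Real.exp (-(2 * l * t)) * ‖expConv r u t‖ ^ 2 ≤
      ∫ t in Ioc 0 T, Real.exp (-(2 * l * t)) * inner ℝ (u t) (expConv r u t) := fun r => by
    rw [← intervalIntegral.integral_of_le hT]
    exact energy_expConv hT hu1
  have hmeas : AEStronglyMeasurable (fun p : ℝ × ℝ =>
        (p.2 + l) * (Real.exp (-(2 * l * p.1)) * ‖expConv p.2 u p.1‖ ^ 2))
      ((volume.restrict (Ioc 0 T)).prod (kernelMeasure α)) :=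
    (by fun_prop : Measurable fun p : ℝ × ℝ => p.2 + l).aestronglyMeasurable.mul
      ((by fun_prop : Measurable fun p : ℝ × ℝ =>
        Real.exp (-(2 * l * p.1))).aestronglyMeasurable.mul
      ((aestronglyMeasurable_expConv _ hu.1).norm.pow 2))
  have hN0 : ∀ r : ℝ, 0 ≤ ∫ t in 0..T, Real.exp (-(2 * l * t)) * ‖expConv r u t‖ ^ 2 :=
    fun r => intervalIntegral.integral_nonneg hT fun t _ => by positivity
  have hN : Integrable
      (fun r => (r + l) * ∫ t in 0..T, Real.exp (-(2 * l * t)) * ‖expConv r u t‖ ^ 2)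
      -- The energy inequality dominates this nonnegative function of `r` by the inner integral of
      -- `⟨u, y_r⟩`, which is integrable by Fubini.
      (kernelMeasure α) := by
    refine hΦ.mono ?_ ?_
    · have := hmeas.prod_swap.integral_prod_right'
      refine this.congr (Filter.Eventually.of_forall fun r => ?_)
      simp only [Prod.swap, integral_const_mul, intervalIntegral.integral_of_le hT]
    · filter_upwards [ae_pos_kernelMeasure α] with r hr
      rw [Real.norm_eq_abs, abs_of_nonneg (mul_nonneg (by linarith) (hN0 r))]
      exact (hen r).trans (le_abs_self _)
  refine ⟨?_, ?_⟩
  · rw [integrable_prod_iff' hmeas]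
    refine ⟨Filter.Eventually.of_forall fun r => ?_, hN.congr ?_⟩
    · have hc : ContinuousOn (fun t => (r + l) * (Real.exp (-(2 * l * t)) * ‖expConv r u t‖ ^ 2))
          (uIcc 0 T) :=
        continuousOn_const.mul ((by fun_prop : Continuous fun t : ℝ =>
          Real.exp (-(2 * l * t))).continuousOn.mul ((continuousOn_expConv hu1).norm.pow 2))
      exact hc.intervalIntegrable.1
    · filter_upwards [ae_pos_kernelMeasure α] with r hr
      rw [← intervalIntegral.integral_const_mul, intervalIntegral.integral_of_le hT]
      refine integral_congr_ae (Filter.Eventually.of_forall fun t => ?_)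
      simp only
      rw [Real.norm_eq_abs, abs_of_nonneg (by positivity)]
  -- Integrate the energy inequality in `r`, then exchange the integrals to reassemble `I^α u`.
  · refine (integral_mono hN hΦ hen).trans_eq ?_
    rw [← integral_integral_swap hI, intervalIntegral.integral_of_le hT]
    refine integral_congr_ae ?_
    filter_upwards [hi, ae_restrict_mem measurableSet_Ioc] with t hit ht
    have h := fracInt_eq_integral_expConv hα ht.1.le
      (hu.1.mono_measure (Measure.restrict_mono_set _ (Ioc_subset_Ioc_right ht.2))) hit
    rw [integral_const_mul, integral_inner h.1, h.2]

/-- Cauchy-Schwarz in `r` with weight `r + l`, pointwise in `t`, followed by `integral_energy_le`.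
-/
theorem integral_fracInt_sq_le [CompleteSpace H] (hα : α ∈ Ioo (0 : ℝ) 1) {T l : ℝ} (hT : 0 ≤ T)
    (hl : 1 ≤ l) {u : ℝ → H} (hu : MemLp u 2 (volume.restrict (Ioc 0 T)))
    (hi : ∀ᵐ t ∂(volume.restrict (Ioc 0 T)),
      IntervalIntegrable (fun s => omega α (t - s) • u s) volume 0 t) :
    ∫ t in 0..T, Real.exp (-(2 * l * t)) * ‖fracInt α u t‖ ^ 2 ≤
      (∫ r, (r + l)⁻¹ ∂(kernelMeasure α)) *
        ∫ t in 0..T, Real.exp (-(2 * l * t)) * inner ℝ (u t) (fracInt α u t) := by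
  obtain ⟨hJ, hle⟩ := integral_energy_le hα hT (zero_le_one.trans hl) hu hi
  have hK0 : 0 ≤ ∫ r, (r + l)⁻¹ ∂(kernelMeasure α) := by
    refine integral_nonneg_of_ae ?_
    filter_upwards [ae_pos_kernelMeasure α] with r hr
    simp only [Pi.zero_apply]
    positivity
  refine le_trans ?_ (mul_le_mul_of_nonneg_left hle hK0)
  have hρi : Integrable (fun r => (r + l)⁻¹) (kernelMeasure α) := by
    refine (integrable_inv_kernelMeasure hα).mono
      (by fun_prop : Measurable fun r : ℝ => (r + l)⁻¹).aestronglyMeasurable ?_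
    filter_upwards [ae_pos_kernelMeasure α] with r hr
    rw [Real.norm_eq_abs, Real.norm_eq_abs, abs_of_pos (by positivity), abs_of_pos (by positivity)]
    exact inv_anti₀ (by linarith) (by linarith)
  have hswap : ∫ r, (r + l) * (∫ t in 0..T, Real.exp (-(2 * l * t)) * ‖expConv r u t‖ ^ 2)
      ∂(kernelMeasure α) = ∫ t in Ioc 0 T, ∫ r, (r + l) *
        (Real.exp (-(2 * l * t)) * ‖expConv r u t‖ ^ 2) ∂(kernelMeasure α) := by
    rw [integral_integral_swap hJ]
    simp only [integral_const_mul, intervalIntegral.integral_of_le hT]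
  rw [hswap, ← integral_const_mul, intervalIntegral.integral_of_le hT]
  refine integral_mono_of_nonneg (Filter.Eventually.of_forall fun t => by positivity)
    (hJ.integral_prod_left.const_mul _) ?_
  filter_upwards [hi, ae_restrict_mem measurableSet_Ioc, hJ.prod_right_ae] with t hit ht hJt
  have h := fracInt_eq_integral_expConv hα ht.1.le
    (hu.1.mono_measure (Measure.restrict_mono_set _ (Ioc_subset_Ioc_right ht.2))) hit
  have he := Real.exp_pos (-(2 * l * t))
  have hJt' : Integrable (fun r => (r + l) * ‖expConv r u t‖ ^ 2) (kernelMeasure α) := by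
    refine (hJt.const_mul (Real.exp (-(2 * l * t)))⁻¹).congr
      (Filter.Eventually.of_forall fun r => ?_)
    simp only
    field_simp
  have hcs := sq_integral_le_weighted (μ := kernelMeasure α) (ρ := fun r => r + l)
    (g := fun r => ‖expConv r u t‖) (by
      filter_upwards [ae_pos_kernelMeasure α] with r hr; linarith) hρi h.1.norm hJt'
  have hw : ‖fracInt α u t‖ ^ 2 ≤ (∫ r, ‖expConv r u t‖ ∂(kernelMeasure α)) ^ 2 := by
    rw [← h.2]
    exact pow_le_pow_left₀ (norm_nonneg _) (norm_integral_le_integral_norm _) 2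
  have hpull : ∫ r, (r + l) * (Real.exp (-(2 * l * t)) * ‖expConv r u t‖ ^ 2) ∂(kernelMeasure α) =
      Real.exp (-(2 * l * t)) * ∫ r, (r + l) * ‖expConv r u t‖ ^ 2 ∂(kernelMeasure α) := by
    rw [← integral_const_mul]
    congr 1
    ext r
    ring
  simp only [hpull]
  have := mul_le_mul_of_nonneg_left (hw.trans hcs) he.le
  linarith

/-- Each `y_r` with `0 < r ≤ 1` recovers the primitive of `u` through `primitive_eq_expConv_add`,
with constants uniform in `r`. Integrating over `(0,1]`, which has finite positive `kernelMeasure`,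
brings in the superposed energy. -/
theorem integral_primitive_sq_le [CompleteSpace H] (hα : α ∈ Ioo (0 : ℝ) 1) {T l : ℝ} (hT : 0 ≤ T)
    (hl : 0 ≤ l) {u : ℝ → H} (hu : MemLp u 2 (volume.restrict (Ioc 0 T)))
    (hi : ∀ᵐ t ∂(volume.restrict (Ioc 0 T)),
      IntervalIntegrable (fun s => omega α (t - s) • u s) volume 0 t) :
    (kernelMeasure α).real (Ioc 0 1) * l *
        ∫ t in 0..T, Real.exp (-(2 * l * t)) * ‖∫ s in 0..t, u s‖ ^ 2 ≤
      (2 + 2 * T ^ 2) * ∫ t in 0..T, Real.exp (-(2 * l * t)) * inner ℝ (u t) (fracInt α u t) := by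
  obtain ⟨hJ, hle⟩ := integral_energy_le hα hT hl hu hi
  have hu1 : IntervalIntegrable u volume 0 T := by
    rw [intervalIntegrable_iff_integrableOn_Ioc_of_le hT]
    exact hu.integrable one_le_two
  have hN0 : ∀ r : ℝ, 0 ≤ ∫ t in 0..T, Real.exp (-(2 * l * t)) * ‖expConv r u t‖ ^ 2 :=
    fun r => intervalIntegral.integral_nonneg hT fun t _ => by positivity
  have hN : Integrable
      (fun r => (r + l) * ∫ t in 0..T, Real.exp (-(2 * l * t)) * ‖expConv r u t‖ ^ 2)
      (kernelMeasure α) := by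
    have := hJ.integral_prod_right
    simpa only [← intervalIntegral.integral_of_le hT, intervalIntegral.integral_const_mul] using this
  refine le_trans ?_ (mul_le_mul_of_nonneg_left hle (by positivity))
  have hce : Continuous fun t : ℝ => Real.exp (-(2 * l * t)) := by fun_prop
  have hpt : ∀ r ∈ Ioc (0 : ℝ) 1,
      l * ∫ t in 0..T, Real.exp (-(2 * l * t)) * ‖∫ s in 0..t, u s‖ ^ 2 ≤
      (2 + 2 * T ^ 2) *
        ((r + l) * ∫ t in 0..T, Real.exp (-(2 * l * t)) * ‖expConv r u t‖ ^ 2) := by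
    intro r hr
    have hyc := continuousOn_expConv (r := r) hu1
    have hz : ContinuousOn (fun t => ∫ s in 0..t, u s) (uIcc 0 T) :=
      intervalIntegral.continuousOn_primitive_interval' hu1 left_mem_uIcc
    have hp : ContinuousOn (fun t => ∫ s in 0..t, ‖expConv r u s‖) (uIcc 0 T) :=
      intervalIntegral.continuousOn_primitive_interval' hyc.norm.intervalIntegrable left_mem_uIcc
    have hH := integral_exp_sq_primitive_le hT hl hyc.norm.intervalIntegrable
      (hyc.norm.pow 2).intervalIntegrable
    have h1 : ∫ t in 0..T, Real.exp (-(2 * l * t)) * ‖∫ s in 0..t, u s‖ ^ 2 ≤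
        ∫ t in 0..T, (2 * (Real.exp (-(2 * l * t)) * ‖expConv r u t‖ ^ 2) +
          2 * (Real.exp (-(2 * l * t)) * (∫ s in 0..t, ‖expConv r u s‖) ^ 2)) := by
      refine intervalIntegral.integral_mono_on hT
        (hce.continuousOn.mul (hz.norm.pow 2)).intervalIntegrable
        ((continuousOn_const.mul (hce.continuousOn.mul (hyc.norm.pow 2))).add
          (continuousOn_const.mul (hce.continuousOn.mul (hp.pow 2)))).intervalIntegrable
        fun t ht => ?_
      rw [primitive_eq_expConv_add r ht.1 (hu1.mono_set (by
        rw [uIcc_of_le ht.1, uIcc_of_le hT]; exact Icc_subset_Icc_right ht.2))]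
      have h2 : ‖expConv r u t + r • ∫ s in 0..t, expConv r u s‖ ≤
          ‖expConv r u t‖ + ∫ s in 0..t, ‖expConv r u s‖ := by
        refine (norm_add_le _ _).trans (add_le_add le_rfl ?_)
        rw [norm_smul, Real.norm_eq_abs, abs_of_pos hr.1]
        exact (mul_le_of_le_one_left (norm_nonneg _) hr.2).trans
          (intervalIntegral.norm_integral_le_integral_norm ht.1)
      have h3 := pow_le_pow_left₀ (norm_nonneg _) h2 2
      have h4 : (‖expConv r u t‖ + ∫ s in 0..t, ‖expConv r u s‖) ^ 2 ≤
          2 * ‖expConv r u t‖ ^ 2 + 2 * (∫ s in 0..t, ‖expConv r u s‖) ^ 2 := by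
        nlinarith [sq_nonneg (‖expConv r u t‖ - ∫ s in 0..t, ‖expConv r u s‖)]
      have := mul_le_mul_of_nonneg_left (h3.trans h4) (Real.exp_pos (-(2 * l * t))).le
      linarith
    have hi1 : IntervalIntegrable
        (fun t => 2 * (Real.exp (-(2 * l * t)) * ‖expConv r u t‖ ^ 2)) volume 0 T :=
      (continuousOn_const.mul (hce.continuousOn.mul (hyc.norm.pow 2))).intervalIntegrable
    have hi2 : IntervalIntegrable (fun t => 2 * (Real.exp (-(2 * l * t)) *
        (∫ s in 0..t, ‖expConv r u s‖) ^ 2)) volume 0 T :=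
      (continuousOn_const.mul (hce.continuousOn.mul (hp.pow 2))).intervalIntegrable
    rw [intervalIntegral.integral_add hi1 hi2,
      intervalIntegral.integral_const_mul, intervalIntegral.integral_const_mul] at h1
    have h5 : ∫ t in 0..T, Real.exp (-(2 * l * t)) * ‖∫ s in 0..t, u s‖ ^ 2 ≤
        (2 + 2 * T ^ 2) * ∫ t in 0..T, Real.exp (-(2 * l * t)) * ‖expConv r u t‖ ^ 2 := by
      linarith
    have h6 := mul_le_mul_of_nonneg_left h5 hl
    -- The nonnegative contribution of `r` is added to enlarge `l` to `r + l`.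
    have h7 := mul_nonneg (mul_nonneg hr.1.le (hN0 r)) (by positivity : 0 ≤ 2 + 2 * T ^ 2)
    nlinarith
  calc _ = ∫ r in Ioc 0 1, (l * ∫ t in 0..T, Real.exp (-(2 * l * t)) * ‖∫ s in 0..t, u s‖ ^ 2)
        ∂(kernelMeasure α) := by
        rw [setIntegral_const, smul_eq_mul]; ring
    _ ≤ ∫ r in Ioc 0 1, (2 + 2 * T ^ 2) *
        ((r + l) * ∫ t in 0..T, Real.exp (-(2 * l * t)) * ‖expConv r u t‖ ^ 2)
        ∂(kernelMeasure α) :=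
        setIntegral_mono_on (integrableOn_const (kernelMeasure_Ioc_ne_top hα))
          (hN.const_mul _).integrableOn measurableSet_Ioc hpt
    _ ≤ ∫ r, (2 + 2 * T ^ 2) *
        ((r + l) * ∫ t in 0..T, Real.exp (-(2 * l * t)) * ‖expConv r u t‖ ^ 2)
        ∂(kernelMeasure α) := by
        refine setIntegral_le_integral (hN.const_mul _) ?_
        filter_upwards [ae_pos_kernelMeasure α] with r hr
        exact mul_nonneg (by positivity) (mul_nonneg (by linarith) (hN0 r))
    _ = _ := integral_const_mul _ _

/-- Coercivity of the fractional integral in exponentially weighted norms: the constant can be made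
arbitrarily large by increasing the weight. -/
theorem exists_weight_coercive [CompleteSpace H] (hα : α ∈ Ioo (0 : ℝ) 1) {T : ℝ} (hT : 0 ≤ T)
    {C : ℝ} (hC : 0 < C) : ∃ l : ℝ, 0 ≤ l ∧ ∀ u : ℝ → H, MemLp u 2 (volume.restrict (Ioc 0 T)) →
      (∀ᵐ t ∂(volume.restrict (Ioc 0 T)),
        IntervalIntegrable (fun s => omega α (t - s) • u s) volume 0 t) →
      C * ((∫ t in 0..T, Real.exp (-(2 * l * t)) * ‖fracInt α u t‖ ^ 2) +
          ∫ t in 0..T, Real.exp (-(2 * l * t)) * ‖∫ s in 0..t, u s‖ ^ 2) ≤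
        ∫ t in 0..T, Real.exp (-(2 * l * t)) * inner ℝ (u t) (fracInt α u t) := by
  have hc : 0 < (kernelMeasure α).real (Ioc 0 1) :=
    ENNReal.toReal_pos (kernelMeasure_Ioc_ne_zero hα) (kernelMeasure_Ioc_ne_top hα)
  set c := (kernelMeasure α).real (Ioc 0 1)
  -- Each of the two terms must cost at most half of the right side, hence `2 * C` in both
  -- thresholds.
  obtain ⟨l, hl1, hl2, hl3⟩ := ((Filter.eventually_ge_atTop (1 : ℝ)).and
    (((tendsto_integral_inv_kernelMeasure hα).eventually_le_const
      (by positivity : 0 < (2 * C)⁻¹)).and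
    (Filter.eventually_ge_atTop (2 * C * (2 + 2 * T ^ 2) / c)))).exists
  refine ⟨l, zero_le_one.trans hl1, fun u hu hi => ?_⟩
  have h1 := integral_fracInt_sq_le hα hT hl1 hu hi
  have h2 := integral_primitive_sq_le hα hT (zero_le_one.trans hl1) hu hi
  set A := ∫ t in 0..T, Real.exp (-(2 * l * t)) * inner ℝ (u t) (fracInt α u t)
  set Z := ∫ t in 0..T, Real.exp (-(2 * l * t)) * ‖∫ s in 0..t, u s‖ ^ 2
  have hZ : 0 ≤ Z := intervalIntegral.integral_nonneg hT fun t _ => by positivity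
  -- The sign of `A` is needed to replace the kernel integral by its upper bound `(2 * C)⁻¹`.
  have hA : 0 ≤ A := by
    have : 0 ≤ c * l * Z := by positivity
    have := this.trans h2
    exact nonneg_of_mul_nonneg_right this (by positivity)
  have h3 := h1.trans (mul_le_mul_of_nonneg_right hl2 hA)
  have h4 : 2 * C * Z * (2 + 2 * T ^ 2) ≤ (2 + 2 * T ^ 2) * A := by
    rw [div_le_iff₀ hc] at hl3
    have := mul_le_mul_of_nonneg_right hl3 hZ
    nlinarith
  have h5 : 2 * C * Z ≤ A := by
    rw [mul_comm] at h4
    exact le_of_mul_le_mul_left h4 (by positivity)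
  have h6 := mul_le_mul_of_nonneg_left h3 hC.le
  have h7 : C * ((2 * C)⁻¹ * A) = A / 2 := by field_simp
  rw [mul_add]
  linarith

end Coercivity

/-! ### The space `H10`: differences and density -/

section Sobolev

variable {d : ℕ} {Ω : Set (E d)}

theorem IsTestFunction.sub {φ χ : E d → ℝ} (hφ : IsTestFunction Ω φ) (hχ : IsTestFunction Ω χ) :
    IsTestFunction Ω (φ - χ) :=
  ⟨hφ.1.sub hχ.1, hφ.2.1.sub hχ.2.1,
    (tsupport_sub φ χ).trans (union_subset hφ.2.2 hχ.2.2)⟩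

theorem IsTestFunction.gradient_sub {φ χ : E d → ℝ} (hφ : IsTestFunction Ω φ)
    (hχ : IsTestFunction Ω χ) : gradient (φ - χ) = gradient φ - gradient χ := by
  ext1 x
  have h1 : DifferentiableAt ℝ φ x := (hφ.1.differentiable (by simp)) x
  have h2 : DifferentiableAt ℝ χ x := (hχ.1.differentiable (by simp)) x
  simp only [gradient, Pi.sub_apply, fderiv_sub h1 h2, map_sub]

/-- Makes the difference of the two fractional integrals, paired with the difference of their
gradients, an admissible test function. -/
theorem H10_sub_mem {v w : LpOn Ω ℝ 2 × LpOn Ω (E d) 2} (hv : v ∈ H10 Ω) (hw : w ∈ H10 Ω) :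
    v - w ∈ H10 Ω := by
  refine map_mem_closure₂ continuous_sub hv hw ?_
  rintro a ⟨φ, hφ, ha1, ha2⟩ b ⟨χ, hχ, hb1, hb2⟩
  refine ⟨φ - χ, hφ.sub hχ, ?_, ?_⟩
  · exact (Lp.coeFn_sub a.1 b.1).trans (ha1.sub hb1)
  · rw [hφ.gradient_sub hχ]
    exact (Lp.coeFn_sub a.2 b.2).trans (ha2.sub hb2)

theorem IsTestFunction.exists_mem_H10 {φ : E d → ℝ} (hφ : IsTestFunction Ω φ) :
    ∃ v ∈ H10 Ω, v.1 =ᵐ[volume.restrict Ω] φ := by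
  have hg : gradient φ = (InnerProductSpace.toDual ℝ (E d)).symm ∘ fderiv ℝ φ := rfl
  have h1 : MemLp φ 2 (volume.restrict Ω) :=
    hφ.1.continuous.memLp_of_hasCompactSupport hφ.2.1
  have h2 : MemLp (gradient φ) 2 (volume.restrict Ω) := by
    refine Continuous.memLp_of_hasCompactSupport ?_ ?_
    · rw [hg]
      exact (LinearIsometryEquiv.continuous _).comp (hφ.1.continuous_fderiv (by simp))
    · rw [hg]
      exact (hφ.2.1.fderiv ℝ).comp_left (map_zero _)
  exact ⟨(h1.toLp φ, h2.toLp _), subset_closure ⟨φ, hφ, h1.coeFn_toLp, h2.coeFn_toLp⟩,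
    h1.coeFn_toLp⟩

/-- `H^1_0(Ω)` is dense in `L_2(Ω)`. -/
theorem eq_zero_of_forall_H10 (hΩ : IsOpen Ω) (hb : Bornology.IsBounded Ω) {q : LpOn Ω ℝ 2}
    (h : ∀ v ∈ H10 Ω, inner ℝ q v.1 = 0) : q = 0 := by
  have : IsFiniteMeasure (volume.restrict Ω) := ⟨by
    rw [Measure.restrict_apply_univ]; exact hb.measure_lt_top⟩
  have hq : IntegrableOn q Ω := (Lp.memLp q).integrable one_le_two
  have key := hΩ.ae_eq_zero_of_integral_contDiff_smul_eq_zero hq.locallyIntegrableOn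
    fun φ h1 h2 h3 => by
      obtain ⟨v, hv, hvφ⟩ := IsTestFunction.exists_mem_H10 (Ω := Ω) ⟨h1, h2, h3⟩
      have := h v hv
      rw [L2.inner_def] at this
      rw [← this, ← setIntegral_eq_integral_of_forall_compl_eq_zero (s := Ω)]
      · refine integral_congr_ae ?_
        filter_upwards [hvφ] with x hx
        simp [hx]
      · intro x hx
        rw [image_eq_zero_of_notMem_tsupport fun hx' => hx (h3 hx'), zero_smul]
  rw [Lp.eq_zero_iff_ae_eq_zero]
  exact (ae_restrict_iff' hΩ.measurableSet).2 key

end Sobolev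

/-! ### The elliptic form of `κ` -/

section Form

variable {d : ℕ} {Ω : Set (E d)} {D : Data Ω} {T : ℝ}

theorem memLp_coord (p : LpOn Ω (E d) 2) (i : Fin d) :
    MemLp (fun x => (p x).ofLp i) 2 (volume.restrict Ω) :=
  (EuclideanSpace.proj (𝕜 := ℝ) i).comp_memLp' (Lp.memLp p)

theorem integrable_kappaForm (hD : D.Admissible T) (p q : LpOn Ω (E d) 2) :
    IntegrableOn (fun x => (D.κ x).mulVec (p x).ofLp ⬝ᵥ (q x).ofLp) Ω := by
  simp only [dotProduct, Matrix.mulVec, Finset.sum_mul]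
  refine integrable_finsetSum _ fun i _ => integrable_finsetSum _ fun j _ => ?_
  have h1 : MemLp (fun x => D.κ x i j * (p x).ofLp j) 2 (volume.restrict Ω) :=
    (memLp_coord p j).mul' (hD.kappa_bounded i j)
  exact h1.integrable_mul (memLp_coord q i)

theorem kappaForm_sub_left (hD : D.Admissible T) (p₁ p₂ q : LpOn Ω (E d) 2) :
    D.kappaForm (p₁ - p₂) q = D.kappaForm p₁ q - D.kappaForm p₂ q := by
  simp only [Data.kappaForm]
  rw [← integral_sub (integrable_kappaForm hD p₁ q) (integrable_kappaForm hD p₂ q)]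
  refine integral_congr_ae ?_
  filter_upwards [Lp.coeFn_sub p₁ p₂] with x hx
  rw [hx, Pi.sub_apply, WithLp.ofLp_sub, Matrix.mulVec_sub, sub_dotProduct]

theorem exists_kappaForm_coercive (hD : D.Admissible T) :
    ∃ c > 0, ∀ p : LpOn Ω (E d) 2, c * ‖p‖ ^ 2 ≤ D.kappaForm p p := by
  obtain ⟨c, hc, h⟩ := hD.kappa_elliptic
  refine ⟨c, hc, fun p => ?_⟩
  rw [← real_inner_self_eq_norm_sq, L2.inner_def, ← integral_const_mul]
  refine integral_mono_ae ((L2.integrable_inner p p).const_mul c) (integrable_kappaForm hD p p) ?_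
  filter_upwards [h] with x hx
  have := hx (p x).ofLp
  have hn : inner ℝ (p x) (p x) = (p x).ofLp ⬝ᵥ (p x).ofLp := by
    rw [real_inner_self_eq_norm_sq, EuclideanSpace.real_norm_sq_eq, dotProduct]
    simp only [sq]
  change c * inner ℝ (p x) (p x) ≤ (D.κ x).mulVec (p x).ofLp ⬝ᵥ (p x).ofLp
  rw [dotProduct_comm ((D.κ x).mulVec _), hn]
  exact this

end Form

/-! ### Bounds for the memory operators -/

section Operators

variable {d : ℕ} {Ω : Set (E d)} {V : Type} [NormedAddCommGroup V] [NormedSpace ℝ V]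

theorem Lp_sub_smul (f g : LpOn Ω ℝ 2) (ψ : LpOn Ω V ⊤) :
    ((f - g) • ψ : LpOn Ω V 2) = (f • ψ : LpOn Ω V 2) - (g • ψ : LpOn Ω V 2) := by
  rw [sub_eq_add_neg, Lp.smul_add, Lp.neg_smul, ← sub_eq_add_neg]

theorem exists_bound_of_contDiffOn {T : ℝ} (hT : 0 < T) {X : Type*} [NormedAddCommGroup X]
    [NormedSpace ℝ X] {ψ : ℝ → X} (hψ : ContDiffOn ℝ 1 ψ (Icc 0 T)) :
    ContinuousOn (derivWithin ψ (Icc 0 T)) (Icc 0 T) ∧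
    ∃ M, 0 ≤ M ∧ ∀ t ∈ Icc 0 T, ‖ψ t‖ ≤ M ∧ ‖derivWithin ψ (Icc 0 T) t‖ ≤ M := by
  have hc := hψ.continuousOn_derivWithin (uniqueDiffOn_Icc hT) le_rfl
  obtain ⟨M₁, h₁⟩ := isCompact_Icc.exists_bound_of_continuousOn hψ.continuousOn
  obtain ⟨M₂, h₂⟩ := isCompact_Icc.exists_bound_of_continuousOn hc
  refine ⟨hc, max M₁ M₂, ?_, fun t ht =>
    ⟨(h₁ t ht).trans (le_max_left _ _), (h₂ t ht).trans (le_max_right _ _)⟩⟩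
  exact (norm_nonneg _).trans ((h₁ 0 ⟨le_rfl, hT.le⟩).trans (le_max_left _ _))

theorem integrableOn_smul_coeff {T M : ℝ} {W : ℝ → LpOn Ω ℝ 2} {ψ : ℝ → LpOn Ω V ⊤}
    (hW : IntegrableOn W (Ioc 0 T)) (hψ : ContinuousOn ψ (Icc 0 T))
    (hM : ∀ t ∈ Icc 0 T, ‖ψ t‖ ≤ M) :
    IntegrableOn (fun s => (W s • ψ s : LpOn Ω V 2)) (Ioc 0 T) := by
  -- The pointwise product is a continuous bilinear map `L_2 × L_∞ → L_2`, hence preserves strong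
  -- measurability.
  have hm : AEStronglyMeasurable (fun s => (W s • ψ s : LpOn Ω V 2))
      (volume.restrict (Ioc 0 T)) :=
    ((ContinuousLinearMap.lsmul ℝ ℝ : ℝ →L[ℝ] V →L[ℝ] V).holderL (volume.restrict Ω) 2 ⊤ 2
      |>.aestronglyMeasurable_comp₂ hW.1
        ((hψ.mono Ioc_subset_Icc_self).aestronglyMeasurable measurableSet_Ioc))
  refine (hW.norm.mul_const M).mono hm ?_
  filter_upwards [ae_restrict_mem measurableSet_Ioc] with s hs
  refine (Lp.norm_smul_le _ _).trans ((mul_le_mul_of_nonneg_left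
    (hM s (Ioc_subset_Icc_self hs)) (norm_nonneg _)).trans (le_abs_self _))

/-- The operator `B^μ_ψ` is controlled by the fractional integral. -/
theorem exists_bound_opB_sub {T μ : ℝ} (hT : 0 < T) {ψ : ℝ → LpOn Ω V ⊤}
    (hψ : ContDiffOn ℝ 1 ψ (Icc 0 T)) :
    ∃ M, 0 ≤ M ∧ ∀ φ₁ φ₂ : ℝ → LpOn Ω ℝ 2, IntegrableOn (fracInt μ φ₁) (Ioc 0 T) →
      IntegrableOn (fracInt μ φ₂) (Ioc 0 T) → ∀ t ∈ Icc 0 T,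
      ‖opB T μ ψ φ₁ t - opB T μ ψ φ₂ t‖ ≤ M * (‖fracInt μ φ₁ t - fracInt μ φ₂ t‖ +
        ∫ s in 0..t, ‖fracInt μ φ₁ s - fracInt μ φ₂ s‖) := by
  obtain ⟨hc, M, hM0, hM⟩ := exists_bound_of_contDiffOn hT hψ
  refine ⟨M, hM0, fun φ₁ φ₂ h₁ h₂ t ht => ?_⟩
  have hii : ∀ W : ℝ → LpOn Ω ℝ 2, IntegrableOn W (Ioc 0 T) → IntervalIntegrable
      (fun s => (W s • derivWithin ψ (Icc 0 T) s : LpOn Ω V 2)) volume 0 t := fun W hW => by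
    rw [intervalIntegrable_iff_integrableOn_Ioc_of_le ht.1]
    exact (integrableOn_smul_coeff hW hc fun s hs => (hM s hs).2).mono_set
      (Ioc_subset_Ioc_right ht.2)
  have heq : opB T μ ψ φ₁ t - opB T μ ψ φ₂ t =
      ((fracInt μ φ₁ t - fracInt μ φ₂ t) • ψ t : LpOn Ω V 2) -
      ∫ s in 0..t, ((fracInt μ φ₁ s - fracInt μ φ₂ s) • derivWithin ψ (Icc 0 T) s :
        LpOn Ω V 2) := by
    simp only [Lp_sub_smul]
    rw [intervalIntegral.integral_sub (hii _ h₁) (hii _ h₂), opB, opB]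
    abel
  rw [heq, mul_add, ← intervalIntegral.integral_const_mul]
  refine (norm_sub_le _ _).trans (add_le_add ?_ ?_)
  · rw [mul_comm]
    exact (Lp.norm_smul_le _ _).trans
      (mul_le_mul_of_nonneg_left (hM t ht).1 (norm_nonneg _))
  · refine intervalIntegral.norm_integral_le_of_norm_le ht.1
      (Filter.Eventually.of_forall fun s hs => ?_) ?_
    · rw [mul_comm]
      exact (Lp.norm_smul_le _ _).trans
        (mul_le_mul_of_nonneg_left (hM s ⟨hs.1.le, hs.2.trans ht.2⟩).2 (norm_nonneg _))
    · rw [intervalIntegrable_iff_integrableOn_Ioc_of_le ht.1]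
      have h : IntegrableOn (fun s => M * ‖fracInt μ φ₁ s - fracInt μ φ₂ s‖) (Ioc 0 T) :=
        ((h₁.sub h₂).norm).const_mul M
      exact h.mono_set (Ioc_subset_Ioc_right ht.2)

theorem fracInt_one {X : Type} [NormedAddCommGroup X] [NormedSpace ℝ X] (u : ℝ → X) (t : ℝ) :
    fracInt 1 u t = ∫ s in 0..t, u s := by
  simp [fracInt, omega]

end Operators

/-! ### The Gronwall argument -/

section Uniqueness

variable {d : ℕ} {Ω : Set (E d)} {D : Data Ω} {T α : ℝ} {u₁ u₂ : ℝ → LpOn Ω ℝ 2}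

/-- The quantity that controls the lower-order operators applied to the difference `u₁ - u₂`. -/
noncomputable def memoryNorm (α : ℝ) (u₁ u₂ : ℝ → LpOn Ω ℝ 2) (t : ℝ) : ℝ :=
  (‖fracInt α u₁ t - fracInt α u₂ t‖ + ∫ s in 0..t, ‖fracInt α u₁ s - fracInt α u₂ s‖) +
  (‖fracInt 1 u₁ t - fracInt 1 u₂ t‖ + ∫ s in 0..t, ‖fracInt 1 u₁ s - fracInt 1 u₂ s‖)

theorem norm_fracInt_sub_le_memoryNorm {t : ℝ} (ht : 0 ≤ t) :
    ‖fracInt α u₁ t - fracInt α u₂ t‖ ≤ memoryNorm α u₁ u₂ t := by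
  have h1 : 0 ≤ ∫ s in 0..t, ‖fracInt α u₁ s - fracInt α u₂ s‖ :=
    intervalIntegral.integral_nonneg ht fun s _ => norm_nonneg _
  have h2 : 0 ≤ ∫ s in 0..t, ‖fracInt 1 u₁ s - fracInt 1 u₂ s‖ :=
    intervalIntegral.integral_nonneg ht fun s _ => norm_nonneg _
  have h3 := norm_nonneg (fracInt 1 u₁ t - fracInt 1 u₂ t)
  unfold memoryNorm
  linarith

theorem integrableOn_fracInt_one {u : ℝ → LpOn Ω ℝ 2} (hT : 0 ≤ T) (hu : IntegrableOn u (Ioc 0 T)) :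
    IntegrableOn (fracInt 1 u) (Ioc 0 T) := by
  have hu' := (intervalIntegrable_iff_integrableOn_Ioc_of_le hT).2 hu
  have h : ContinuousOn (fracInt 1 u) (uIcc 0 T) := by
    simp only [funext (fracInt_one u)]
    exact intervalIntegral.continuousOn_primitive_interval' hu' left_mem_uIcc
  exact h.intervalIntegrable.1

theorem exists_bound_B_sub (hT : 0 < T) (hD : D.Admissible T) :
    ∃ M, 0 ≤ M ∧ ∀ u₁ u₂ : ℝ → LpOn Ω ℝ 2,
      IntegrableOn u₁ (Ioc 0 T) → IntegrableOn u₂ (Ioc 0 T) →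
      IntegrableOn (fracInt α u₁) (Ioc 0 T) → IntegrableOn (fracInt α u₂) (Ioc 0 T) →
      ∀ t ∈ Icc 0 T, ‖D.B₁ T α u₁ t - D.B₁ T α u₂ t‖ ≤ M * memoryNorm α u₁ u₂ t ∧
        ‖D.B₂ T α u₁ t - D.B₂ T α u₂ t‖ ≤ M * memoryNorm α u₁ u₂ t := by
  obtain ⟨MF, hF0, hF⟩ := exists_bound_opB_sub (μ := α) hT (hD.F_reg.1.of_le (by norm_num))
  obtain ⟨MG, hG0, hG⟩ := exists_bound_opB_sub (μ := 1) hT (hD.G_reg.1.of_le (by norm_num))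
  obtain ⟨Ma, ha0, ha⟩ := exists_bound_opB_sub (μ := α) hT hD.a_reg
  obtain ⟨Mb, hb0, hb⟩ := exists_bound_opB_sub (μ := 1) hT hD.b_reg
  refine ⟨MF + MG + Ma + Mb, by positivity, fun u₁ u₂ h₁ h₂ hw₁ hw₂ t ht => ?_⟩
  have hz₁ := integrableOn_fracInt_one hT.le h₁
  have hz₂ := integrableOn_fracInt_one hT.le h₂
  have eF := hF u₁ u₂ hw₁ hw₂ t ht
  have eG := hG u₁ u₂ hz₁ hz₂ t ht
  have ea := ha u₁ u₂ hw₁ hw₂ t ht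
  have eb := hb u₁ u₂ hz₁ hz₂ t ht
  unfold memoryNorm
  have hx : 0 ≤ ‖fracInt α u₁ t - fracInt α u₂ t‖ +
      ∫ s in 0..t, ‖fracInt α u₁ s - fracInt α u₂ s‖ :=
    add_nonneg (norm_nonneg _) (intervalIntegral.integral_nonneg ht.1 fun s _ => norm_nonneg _)
  have hy : 0 ≤ ‖fracInt 1 u₁ t - fracInt 1 u₂ t‖ +
      ∫ s in 0..t, ‖fracInt 1 u₁ s - fracInt 1 u₂ s‖ :=
    add_nonneg (norm_nonneg _) (intervalIntegral.integral_nonneg ht.1 fun s _ => norm_nonneg _)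
  set X := ‖fracInt α u₁ t - fracInt α u₂ t‖ +
      ∫ s in 0..t, ‖fracInt α u₁ s - fracInt α u₂ s‖
  set Y := ‖fracInt 1 u₁ t - fracInt 1 u₂ t‖ +
      ∫ s in 0..t, ‖fracInt 1 u₁ s - fracInt 1 u₂ s‖
  constructor
  · rw [Data.B₁, Data.B₁, add_sub_add_comm]
    refine (norm_add_le _ _).trans ((add_le_add eF eG).trans ?_)
    have : 0 ≤ (MG + Ma + Mb) * X + (MF + Ma + Mb) * Y := by positivity
    linarith
  · rw [Data.B₂, Data.B₂, add_sub_add_comm]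
    refine (norm_add_le _ _).trans ((add_le_add ea eb).trans ?_)
    have : 0 ≤ (MF + MG + Mb) * X + (MF + MG + Ma) * Y := by positivity
    linarith

theorem weakEq_sub (hD : D.Admissible T) {p₁ p₂ : LpOn Ω (E d) 2} {t : ℝ}
    (h₁ : D.WeakEqAt T α u₁ p₁ t) (h₂ : D.WeakEqAt T α u₂ p₂ t) {v : LpOn Ω ℝ 2 × LpOn Ω (E d) 2}
    (hv : v ∈ H10 Ω) :
    inner ℝ (u₁ t - u₂ t) v.1 + D.kappaForm (p₁ - p₂) v.2 -
      inner ℝ (D.B₁ T α u₁ t - D.B₁ T α u₂ t) v.2 +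
      inner ℝ (D.B₂ T α u₁ t - D.B₂ T α u₂ t) v.1 = 0 := by
  have e₁ := h₁.2.2 v hv
  have e₂ := h₂.2.2 v hv
  rw [kappaForm_sub_left hD, inner_sub_left, inner_sub_left, inner_sub_left]
  linarith

/-- The test function is the difference of the fractional integrals. Its gradient enters linearly
through `B₁` and quadratically through `κ`, so Young's inequality removes it. -/
theorem inner_sub_fracInt_le (hD : D.Admissible T) {c M S : ℝ} (hc : 0 < c) (hM : 0 ≤ M)
    (hκ : ∀ p : LpOn Ω (E d) 2, c * ‖p‖ ^ 2 ≤ D.kappaForm p p)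
    {p₁ p₂ : LpOn Ω (E d) 2} {t : ℝ}
    (h₁ : D.WeakEqAt T α u₁ p₁ t) (h₂ : D.WeakEqAt T α u₂ p₂ t)
    (hw : ‖fracInt α u₁ t - fracInt α u₂ t‖ ≤ S)
    (hB₁ : ‖D.B₁ T α u₁ t - D.B₁ T α u₂ t‖ ≤ M * S)
    (hB₂ : ‖D.B₂ T α u₁ t - D.B₂ T α u₂ t‖ ≤ M * S) :
    inner ℝ (u₁ t - u₂ t) (fracInt α u₁ t - fracInt α u₂ t) ≤ (M ^ 2 / (4 * c) + M) * S ^ 2 := by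
  have h := weakEq_sub hD h₁ h₂ (H10_sub_mem h₁.2.1 h₂.2.1)
  simp only [Prod.fst_sub, Prod.snd_sub] at h
  have hS : 0 ≤ S := (norm_nonneg _).trans hw
  have hk := hκ (p₁ - p₂)
  have i₁ : inner ℝ (D.B₁ T α u₁ t - D.B₁ T α u₂ t) (p₁ - p₂) ≤ M * S * ‖p₁ - p₂‖ :=
    (real_inner_le_norm _ _).trans (mul_le_mul_of_nonneg_right hB₁ (norm_nonneg _))
  have i₂ : -(M * S * S) ≤ inner ℝ (D.B₂ T α u₁ t - D.B₂ T α u₂ t)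
      (fracInt α u₁ t - fracInt α u₂ t) :=
    (abs_le.1 ((abs_real_inner_le_norm _ _).trans
      (mul_le_mul hB₂ hw (norm_nonneg _) (mul_nonneg hM hS)))).1
  -- Completing the square in `‖p₁ - p₂‖` produces the constant `M ^ 2 / (4 * c)`.
  have hy : M * S * ‖p₁ - p₂‖ - c * ‖p₁ - p₂‖ ^ 2 ≤ M ^ 2 / (4 * c) * S ^ 2 := by
    have : M ^ 2 / (4 * c) * S ^ 2 - (M * S * ‖p₁ - p₂‖ - c * ‖p₁ - p₂‖ ^ 2) =
        c * (‖p₁ - p₂‖ - M * S / (2 * c)) ^ 2 := by field_simp; ring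
    have h0 : 0 ≤ c * (‖p₁ - p₂‖ - M * S / (2 * c)) ^ 2 := by positivity
    linarith
  linarith

/-- Two test functions are used: the difference of the fractional integrals forces the gradients to
agree, after which only `⟨u₁ t - u₂ t, v⟩ = 0` remains for arbitrary `v` in the dense set `H10`. -/
theorem eq_of_fracInt_eq_of_B_eq (hΩ : IsOpen Ω) (hb : Bornology.IsBounded Ω)
    (hD : D.Admissible T) {p₁ p₂ : LpOn Ω (E d) 2} {t : ℝ}
    (h₁ : D.WeakEqAt T α u₁ p₁ t) (h₂ : D.WeakEqAt T α u₂ p₂ t)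
    (hw : fracInt α u₁ t - fracInt α u₂ t = 0)
    (hB₁ : D.B₁ T α u₁ t - D.B₁ T α u₂ t = 0) (hB₂ : D.B₂ T α u₁ t - D.B₂ T α u₂ t = 0) :
    u₁ t = u₂ t := by
  obtain ⟨c, hc, hκ⟩ := exists_kappaForm_coercive hD
  have h := weakEq_sub hD h₁ h₂ (H10_sub_mem h₁.2.1 h₂.2.1)
  simp only [Prod.fst_sub, Prod.snd_sub, hw, hB₁, hB₂, inner_zero_left, inner_zero_right, zero_add,
    sub_zero, add_zero] at h
  have hp : p₁ - p₂ = 0 := by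
    have := hκ (p₁ - p₂)
    rw [h] at this
    have h0 : ‖p₁ - p₂‖ ^ 2 ≤ 0 := by
      by_contra hn
      push Not at hn
      exact absurd this (not_le.2 (mul_pos hc hn))
    exact norm_eq_zero.1 (pow_eq_zero_iff (two_ne_zero) |>.1 (le_antisymm h0 (sq_nonneg _)))
  refine sub_eq_zero.1 (eq_zero_of_forall_H10 hΩ hb fun v hv => ?_)
  have hv' := weakEq_sub hD h₁ h₂ hv
  have hk0 : D.kappaForm (0 : LpOn Ω (E d) 2) v.2 = 0 := by
    have := kappaForm_sub_left hD 0 0 v.2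
    rwa [sub_self, sub_self] at this
  simpa [hp, hB₁, hB₂, hk0] using hv'

theorem ae_eq_zero_of_integral_exp_sq_eq_zero {X : Type*} [NormedAddCommGroup X] {l : ℝ}
    (hT : 0 ≤ T) {W : ℝ → X}
    (hi : IntervalIntegrable (fun t => Real.exp (-(2 * l * t)) * ‖W t‖ ^ 2) volume 0 T)
    (h : ∫ t in 0..T, Real.exp (-(2 * l * t)) * ‖W t‖ ^ 2 = 0) :
    ∀ᵐ t ∂(volume.restrict (Ioc 0 T)), W t = 0 := by
  rw [intervalIntegral.integral_of_le hT, integral_eq_zero_iff_of_nonneg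
    (fun t => by simp only [Pi.zero_apply]; positivity) hi.1] at h
  filter_upwards [h] with t ht
  simpa [(Real.exp_pos _).ne'] using ht

theorem fracInt_sub_eq {t : ℝ}
    (h₁ : IntervalIntegrable (fun s => omega α (t - s) • u₁ s) volume 0 t)
    (h₂ : IntervalIntegrable (fun s => omega α (t - s) • u₂ s) volume 0 t) :
    fracInt α (u₁ - u₂) t = fracInt α u₁ t - fracInt α u₂ t := by
  simp only [fracInt, Pi.sub_apply, smul_sub]
  exact intervalIntegral.integral_sub h₁ h₂

/-- A Gronwall type lemma for the fractional integral. -/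
theorem fracInt_eq_zero_of_inner_le {H : Type} [NormedAddCommGroup H] [InnerProductSpace ℝ H]
    [CompleteSpace H] (hT : 0 < T) (hα : α ∈ Ioo (0 : ℝ) 1) {C : ℝ} (hC : 0 ≤ C) {u : ℝ → H}
    (hu : MemLp u 2 (volume.restrict (Ioc 0 T)))
    (hW : MemLp (fracInt α u) 2 (volume.restrict (Ioc 0 T)))
    (hui : ∀ᵐ t ∂(volume.restrict (Ioc 0 T)),
      IntervalIntegrable (fun s => omega α (t - s) • u s) volume 0 t)
    (hle : ∀ᵐ t ∂(volume.restrict (Ioc 0 T)), inner ℝ (u t) (fracInt α u t) ≤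
      C * ((‖fracInt α u t‖ + ∫ s in 0..t, ‖fracInt α u s‖) +
        (‖fracInt 1 u t‖ + ∫ s in 0..t, ‖fracInt 1 u s‖)) ^ 2) :
    (∀ᵐ t ∂(volume.restrict (Ioc 0 T)), fracInt α u t = 0) ∧
    ∀ t ∈ Icc 0 T, fracInt 1 u t = 0 := by
  -- The `4` comes from squaring a sum of four terms, `1 + T ^ 2` from absorbing the primitives, and
  -- the `+ 1` leaves a strict surplus.
  obtain ⟨l, hl, hcoer⟩ := exists_weight_coercive (H := H) hα hT.le
    (C := 4 * C * (1 + T ^ 2) + 1) (by positivity)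
  have hco := hcoer u hu hui
  simp only [← fracInt_one u] at hco
  set W : ℝ → H := fracInt α u with hW_def
  set Z : ℝ → H := fracInt 1 u with hZ_def
  have hui1 : IntervalIntegrable u volume 0 T :=
    (intervalIntegrable_iff_integrableOn_Ioc_of_le hT.le).2 (hu.integrable one_le_two)
  have hWi1 : IntervalIntegrable W volume 0 T :=
    (intervalIntegrable_iff_integrableOn_Ioc_of_le hT.le).2 (hW.integrable one_le_two)
  have hZc : ContinuousOn Z (uIcc 0 T) :=
    (intervalIntegral.continuousOn_primitive_interval' hui1 left_mem_uIcc).congr fun t _ =>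
      fracInt_one u t
  have hce : Continuous fun t : ℝ => Real.exp (-(2 * l * t)) := by fun_prop
  have hW2 : IntervalIntegrable (fun t => ‖W t‖ ^ 2) volume 0 T :=
    (intervalIntegrable_iff_integrableOn_Ioc_of_le hT.le).2 hW.norm.integrable_sq
  have hZ2 : IntervalIntegrable (fun t => ‖Z t‖ ^ 2) volume 0 T :=
    (hZc.norm.pow 2).intervalIntegrable
  have hcW : ContinuousOn (fun t => ∫ s in 0..t, ‖W s‖) (uIcc 0 T) :=
    intervalIntegral.continuousOn_primitive_interval' hWi1.norm left_mem_uIcc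
  have hcZ : ContinuousOn (fun t => ∫ s in 0..t, ‖Z s‖) (uIcc 0 T) :=
    intervalIntegral.continuousOn_primitive_interval' hZc.norm.intervalIntegrable left_mem_uIcc
  have j1 := hW2.continuousOn_mul hce.continuousOn
  have j2 : IntervalIntegrable
      (fun t => Real.exp (-(2 * l * t)) * (∫ s in 0..t, ‖W s‖) ^ 2) volume 0 T :=
    (hce.continuousOn.mul (hcW.pow 2)).intervalIntegrable
  have j3 := hZ2.continuousOn_mul hce.continuousOn
  have j4 : IntervalIntegrable
      (fun t => Real.exp (-(2 * l * t)) * (∫ s in 0..t, ‖Z s‖) ^ 2) volume 0 T :=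
    (hce.continuousOn.mul (hcZ.pow 2)).intervalIntegrable
  have g2 := integral_exp_sq_primitive_le hT.le hl hWi1.norm hW2
  have g4 := integral_exp_sq_primitive_le hT.le hl hZc.norm.intervalIntegrable hZ2
  have r3 : ∫ t in 0..T, Real.exp (-(2 * l * t)) * inner ℝ (u t) (W t) ≤
      ∫ t in 0..T, 4 * C * (((Real.exp (-(2 * l * t)) * ‖W t‖ ^ 2 +
        Real.exp (-(2 * l * t)) * (∫ s in 0..t, ‖W s‖) ^ 2) +
        Real.exp (-(2 * l * t)) * ‖Z t‖ ^ 2) +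
        Real.exp (-(2 * l * t)) * (∫ s in 0..t, ‖Z s‖) ^ 2) := by
    rw [intervalIntegral.integral_of_le hT.le, intervalIntegral.integral_of_le hT.le]
    refine integral_mono_ae ?_ ((((j1.add j2).add j3).add j4).const_mul _).1 ?_
    · have hin : Integrable (fun t => inner ℝ (u t) (W t)) (volume.restrict (Ioc 0 T)) :=
        (hu.norm.integrable_mul hW.norm).mono (hu.1.inner hW.1)
          (Filter.Eventually.of_forall fun t => (norm_inner_le_norm _ _).trans (le_abs_self _))
      exact ((intervalIntegrable_iff_integrableOn_Ioc_of_le hT.le).2 hin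
        |>.continuousOn_mul hce.continuousOn).1
    · filter_upwards [hle] with t ht
      have hsq : ∀ a b c d : ℝ, ((a + b) + (c + d)) ^ 2 ≤ 4 * (a ^ 2 + b ^ 2 + c ^ 2 + d ^ 2) :=
        fun a b c d => by
          nlinarith [sq_nonneg (a - b), sq_nonneg (c - d), sq_nonneg (a - c),
            sq_nonneg (a - d), sq_nonneg (b - c), sq_nonneg (b - d)]
      have hfin := mul_le_mul_of_nonneg_left
        (ht.trans (mul_le_mul_of_nonneg_left (hsq _ _ _ _) hC)) (Real.exp_pos (-(2 * l * t))).le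
      refine hfin.trans_eq ?_
      ring
  rw [intervalIntegral.integral_const_mul, intervalIntegral.integral_add ((j1.add j2).add j3) j4,
    intervalIntegral.integral_add (j1.add j2) j3, intervalIntegral.integral_add j1 j2] at r3
  have n1 : 0 ≤ ∫ t in 0..T, Real.exp (-(2 * l * t)) * ‖W t‖ ^ 2 :=
    intervalIntegral.integral_nonneg hT.le fun t _ => by positivity
  have n2 : 0 ≤ ∫ t in 0..T, Real.exp (-(2 * l * t)) * ‖Z t‖ ^ 2 :=
    intervalIntegral.integral_nonneg hT.le fun t _ => by positivity
  have htot := hco.trans r3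
  have hgg := mul_le_mul_of_nonneg_left (add_le_add g2 g4) (by positivity : 0 ≤ 4 * C)
  -- With `w`, `z` the two weighted integrals and `A = 4 * C * (1 + T ^ 2)`, the estimates read `(A
  -- + 1)(w + z) ≤ A (w + z)`, and both integrals are nonnegative.
  have z1 : ∫ t in 0..T, Real.exp (-(2 * l * t)) * ‖W t‖ ^ 2 = 0 := by nlinarith
  have z2 : ∫ t in 0..T, Real.exp (-(2 * l * t)) * ‖Z t‖ ^ 2 = 0 := by nlinarith
  refine ⟨ae_eq_zero_of_integral_exp_sq_eq_zero hT.le j1 z1, ?_⟩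
  have hZ0 := ae_eq_zero_of_integral_exp_sq_eq_zero hT.le j3 z2
  -- Continuity of the primitive upgrades almost every `t` to every `t`.
  rw [uIcc_of_le hT.le] at hZc
  refine Measure.eqOn_Icc_of_ae_eq volume hT.ne ?_ hZc continuousOn_const
  rw [← Measure.restrict_congr_set Ioc_ae_eq_Icc]
  exact hZ0

/-- The fractional integral and the primitive of the difference of two weak solutions vanish. -/
theorem ae_fracInt_eq (hT : 0 < T) (hα : α ∈ Ioo (0 : ℝ) 1) (hD : D.Admissible T)
    (h₁ : D.IsWeakSolution T α u₁) (h₂ : D.IsWeakSolution T α u₂) :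
    (∀ᵐ t ∂(volume.restrict (Ioc 0 T)), fracInt α u₁ t - fracInt α u₂ t = 0) ∧
    ∀ t ∈ Icc 0 T, fracInt 1 u₁ t - fracInt 1 u₂ t = 0 := by
  have hm : volume.restrict (Ioo (0 : ℝ) T) = volume.restrict (Ioc 0 T) :=
    Measure.restrict_congr_set Ioo_ae_eq_Ioc
  obtain ⟨m₁, w₁, P₁, -, e₁⟩ := h₁
  obtain ⟨m₂, w₂, P₂, -, e₂⟩ := h₂
  rw [hm] at m₁ m₂ w₁ w₂ e₁ e₂
  obtain ⟨c, hc, hκ⟩ := exists_kappaForm_coercive hD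
  obtain ⟨M, hM, hB⟩ := exists_bound_B_sub (α := α) hT hD
  have hB := hB u₁ u₂ (m₁.integrable one_le_two) (m₂.integrable one_le_two)
    (w₁.integrable one_le_two) (w₂.integrable one_le_two)
  -- Linearity of the Bochner integral requires both integrals to converge, so this identity is
  -- available only almost everywhere.
  have hWu : ∀ᵐ t ∂(volume.restrict (Ioc 0 T)),
      fracInt α (u₁ - u₂) t = fracInt α u₁ t - fracInt α u₂ t := by
    filter_upwards [e₁, e₂] with t a₁ a₂
    exact fracInt_sub_eq a₁.1 a₂.1
  have hui : ∀ᵐ t ∂(volume.restrict (Ioc 0 T)),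
      IntervalIntegrable (fun s => omega α (t - s) • (u₁ - u₂) s) volume 0 t := by
    filter_upwards [e₁, e₂] with t a₁ a₂
    exact (a₁.1.sub a₂.1).congr fun s _ => (smul_sub (omega α (t - s)) (u₁ s) (u₂ s)).symm
  have hZu : ∀ t ∈ Icc 0 T, fracInt 1 (u₁ - u₂) t = fracInt 1 u₁ t - fracInt 1 u₂ t := by
    intro t ht
    have hint : ∀ {v : ℝ → LpOn Ω ℝ 2}, MemLp v 2 (volume.restrict (Ioc 0 T)) →
        IntervalIntegrable v volume 0 t := fun hv =>
      (intervalIntegrable_iff_integrableOn_Ioc_of_le ht.1).2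
        (IntegrableOn.mono_set (hv.integrable one_le_two) (Ioc_subset_Ioc_right ht.2))
    rw [fracInt_one, fracInt_one, fracInt_one]
    exact intervalIntegral.integral_sub (hint m₁) (hint m₂)
  have hle : ∀ᵐ t ∂(volume.restrict (Ioc 0 T)),
      inner ℝ ((u₁ - u₂) t) (fracInt α (u₁ - u₂) t) ≤ (M ^ 2 / (4 * c) + M) *
        ((‖fracInt α (u₁ - u₂) t‖ + ∫ s in 0..t, ‖fracInt α (u₁ - u₂) s‖) +
        (‖fracInt 1 (u₁ - u₂) t‖ + ∫ s in 0..t, ‖fracInt 1 (u₁ - u₂) s‖)) ^ 2 := by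
    filter_upwards [e₁, e₂, hWu, ae_restrict_mem measurableSet_Ioc] with t a₁ a₂ hWt ht
    have ht' := Ioc_subset_Icc_self ht
    have hle := inner_sub_fracInt_le hD hc hM hκ a₁ a₂ (norm_fracInt_sub_le_memoryNorm ht.1.le)
      (hB t ht').1 (hB t ht').2
    have i1 : ∫ s in 0..t, ‖fracInt α (u₁ - u₂) s‖ =
        ∫ s in 0..t, ‖fracInt α u₁ s - fracInt α u₂ s‖ := by
      rw [intervalIntegral.integral_of_le ht.1.le, intervalIntegral.integral_of_le ht.1.le]
      refine integral_congr_ae ?_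
      filter_upwards [ae_restrict_of_ae_restrict_of_subset (Ioc_subset_Ioc_right ht.2) hWu]
        with s hs
      rw [hs]
    have i2 : ∫ s in 0..t, ‖fracInt 1 (u₁ - u₂) s‖ =
        ∫ s in 0..t, ‖fracInt 1 u₁ s - fracInt 1 u₂ s‖ := by
      rw [intervalIntegral.integral_of_le ht.1.le, intervalIntegral.integral_of_le ht.1.le]
      refine setIntegral_congr_fun measurableSet_Ioc fun s hs => ?_
      rw [hZu s ⟨hs.1.le, hs.2.trans ht.2⟩]
    rw [hWt, hZu t ht', i1, i2]
    exact hle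
  obtain ⟨r₁, r₂⟩ := fracInt_eq_zero_of_inner_le hT hα (by positivity) (m₁.sub m₂)
    ((w₁.sub w₂).ae_eq (hWu.mono fun t ht => ht.symm)) hui hle
  refine ⟨?_, fun t ht => (hZu t ht).symm.trans (r₂ t ht)⟩
  filter_upwards [hWu, r₁] with t a₁ a₂
  rw [← a₁, a₂]

end Uniqueness

end FracPDE

/-! ### Uniqueness almost everywhere and at individual times -/

theorem theorem4p4 {d : ℕ} (hd : 1 ≤ d) (Ω : Set (FracPDE.E d)) (hΩ_open : IsOpen Ω)
    (hΩ_bdd : Bornology.IsBounded Ω) (hΩ_lip : FracPDE.HasLipschitzBoundary Ω)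
    (T : ℝ) (hT : 0 < T) (α : ℝ) (hα : α ∈ Set.Ioo (0 : ℝ) 1)
    (D : FracPDE.Data Ω) (hD : D.Admissible T)
    (u₁ u₂ : ℝ → FracPDE.LpOn Ω ℝ 2)
    (h₁ : D.IsWeakSolution T α u₁) (h₂ : D.IsWeakSolution T α u₂) :
    (∀ᵐ t ∂(volume.restrict (Ioo 0 T)), u₁ t = u₂ t) ∧
    ∀ t ∈ Icc 0 T, (∃ p₁, D.WeakEqAt T α u₁ p₁ t) → (∃ p₂, D.WeakEqAt T α u₂ p₂ t) →
      u₁ t = u₂ t := by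
  have hm : volume.restrict (Ioo (0 : ℝ) T) = volume.restrict (Ioc 0 T) :=
    Measure.restrict_congr_set Ioo_ae_eq_Ioc
  obtain ⟨hW, hZ⟩ := FracPDE.ae_fracInt_eq hT hα hD h₁ h₂
  obtain ⟨m₁, w₁, P₁, -, e₁⟩ := h₁
  obtain ⟨m₂, w₂, P₂, -, e₂⟩ := h₂
  rw [hm] at m₁ m₂ w₁ w₂ e₁ e₂
  rw [hm]
  obtain ⟨M, hM, hB⟩ := FracPDE.exists_bound_B_sub (α := α) hT hD
  have hB := hB u₁ u₂ (m₁.integrable one_le_two) (m₂.integrable one_le_two)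
    (w₁.integrable one_le_two) (w₂.integrable one_le_two)
  -- At a fixed `t`, all parts of `memoryNorm` except the fractional integrals at `t` itself are
  -- already known to vanish, so their equality is the only extra input.
  have key : ∀ t ∈ Icc 0 T, (∃ p₁, D.WeakEqAt T α u₁ p₁ t) → (∃ p₂, D.WeakEqAt T α u₂ p₂ t) →
      FracPDE.fracInt α u₁ t - FracPDE.fracInt α u₂ t = 0 → u₁ t = u₂ t := by
    rintro t ht ⟨p₁, a₁⟩ ⟨p₂, a₂⟩ hw
    have hS : FracPDE.memoryNorm α u₁ u₂ t = 0 := by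
      have i1 : ∫ s in 0..t, ‖FracPDE.fracInt α u₁ s - FracPDE.fracInt α u₂ s‖ = 0 := by
        rw [intervalIntegral.integral_of_le ht.1]
        refine integral_eq_zero_of_ae ?_
        filter_upwards [ae_restrict_of_ae_restrict_of_subset (Ioc_subset_Ioc_right ht.2) hW]
          with s hs
        simp [hs]
      have i2 : ∫ s in 0..t, ‖FracPDE.fracInt 1 u₁ s - FracPDE.fracInt 1 u₂ s‖ = 0 := by
        rw [intervalIntegral.integral_of_le ht.1]
        refine setIntegral_eq_zero_of_forall_eq_zero fun s hs => ?_
        rw [hZ s ⟨hs.1.le, hs.2.trans ht.2⟩, norm_zero]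
      rw [FracPDE.memoryNorm, i1, i2, hw, hZ t ht]
      simp
    have hBt := hB t ht
    rw [hS, mul_zero, norm_le_zero_iff, norm_le_zero_iff] at hBt
    exact FracPDE.eq_of_fracInt_eq_of_B_eq hΩ_open hΩ_bdd hD a₁ a₂ hw hBt.1 hBt.2
  have hae : ∀ᵐ t ∂(volume.restrict (Ioc 0 T)), u₁ t = u₂ t := by
    filter_upwards [e₁, e₂, hW, ae_restrict_mem measurableSet_Ioc] with t a₁ a₂ hw ht
    exact key t (Ioc_subset_Icc_self ht) ⟨_, a₁⟩ ⟨_, a₂⟩ hw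
  refine ⟨hae, fun t ht x₁ x₂ => key t ht x₁ x₂ ?_⟩
  -- Equality of `u₁` and `u₂` almost everywhere makes their fractional integrals agree at every
  -- `t`, which supplies that input.
  rw [sub_eq_zero, FracPDE.fracInt, FracPDE.fracInt, intervalIntegral.integral_of_le ht.1,
    intervalIntegral.integral_of_le ht.1]
  refine integral_congr_ae ?_
  filter_upwards [ae_restrict_of_ae_restrict_of_subset (Ioc_subset_Ioc_right ht.2) hae] with s hs
  rw [hs]
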